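/- **Conventions.** A finite quantum group $\Gamma$ is a finite-dimensional Hopf $*$-algebra $C(\Gamma)$ over $\mathbb C$ (with $\Delta$ and $\epsilon$ $*$-homomorphisms) whose $*$-algebra is a C*-algebra, i.e. admits a faithful positive functional. Write $m,\eta,\Delta,\epsilon,S$ for its structure maps. Its normalized Haar functional $\psi=\eta^\dag$ is the positive, left-invariant functional ($(\psi\otimes\mathrm{id})\Delta(f)=\psi(f)1$) for which $(a,b)\mapsto\psi(ab)$ is non-degenerate and symmetric and $mm^\dag=\mathrm{id}$. Here $\dag$ is the adjoint for the inner product $\langle a,b\rangle=\psi(a^*b)$ and its tensor powers; $l^2(\Gamma)$ is $C(\Gamma)$ with this inner product. For a linear map $A\colon l^2(\Gamma)^{\otimes k}\to l^2(\Gamma)^{\otimes l}$, $A^{\mathsf T}$ is the adjoint for the nested bilinear forms $\beta_k(x_1\otimes\dots\otimes x_k,y_1\otimes\dots\otimes y_k)=\prod_i\psi(x_{k+1-i}\,y_i)$, and $A^*=(A^\dag)^{\mathsf T}$. For $x,y\in l^2(\Gamma)$ put $x\bullet y=m(x\otimes y)$, $x*y=\Delta^\dag(x\otimes y)$, $x^\star=S(x^*)$.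 The dual $\hat\Gamma$ is a finite quantum group whose Hopf $*$-algebra $C(\hat\Gamma)$ is isomorphic to the vector space $C(\Gamma)$ with multiplication $\Delta^\dag$, unit $\epsilon^\dag$, comultiplication $m^\dag$, counit $\eta^\dag$, antipode $S$ and involution $\star$; the isomorphism $\Phi\colon C(\Gamma)\to C(\hat\Gamma)$, $x\mapsto\hat x$, is the Fourier transform, and $\hat A=\Phi^{\otimes l}A(\Phi^{-1})^{\otimes k}$. On $\hat\Gamma$ the symbols $\dag$, ${\mathsf T}$, $*$, $\bullet$, $\star$ refer to $C(\hat\Gamma)$ and its own Haar functional $\hat\psi$. **Theorem.** Let $\Gamma$ be a finite quantum group. Its normalized Haar functional $\psi$ exists and is unique, and $n:=\eta^\dag\eta=\psi(1)=\dim C(\Gamma)$. A dual $\hat\Gamma$ with Fourier transform $\Phi$ exists. For every such $\hat\Gamma$ and $\Phi$, the normalized Haar functional of $\hat\Gamma$ is $\hat\psi=n\,\omega$ with $\omega=\epsilon\circ\Phi^{-1}$, and: 1. for all $k,l\ge 0$ and every linear $A\colon l^2(\Gamma)^{\otimes k}\to l^2(\Gamma)^{\otimes l}$, $$\widehat{A^\dag}=n^{k-l}\hat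 A^\dag,\qquad \widehat{A^{\mathsf T}}=n^{k-l}\,\hat S^{\otimes k}\hat A^{\mathsf T}\hat S^{\otimes l},\qquad \widehat{A^*}=\hat S^{\otimes l}\hat A^*\hat S^{\otimes k};$$ 2. for all $x,y\in l^2(\Gamma)$, $$\widehat{x*y}=\hat x\bullet\hat y,\qquad \widehat{x\bullet y}=\tfrac1n\,\hat x*\hat y,\qquad \widehat{x^\star}=\hat x^*,\qquad \widehat{x^*}=\hat x^\star;$$ 3. if instead the operations $\dag$, ${\mathsf T}$, $*$ (the conjugate of maps and the convolution) on $\hat\Gamma$ are formed with the Haar functional $\frac1n\omega$, then $$\widehat{A^\dag}=n^{l-k}\hat A^\dag,\quad \widehat{A^{\mathsf T}}=n^{l-k}\,\hat S^{\otimes k}\hat A^{\mathsf T}\hat S^{\otimes l},\quad \widehat{A^*}=\hat S^{\otimes l}\hat A^*\hat S^{\otimes k},\quad \widehat{x\bullet y}=n\,\hat x*\hat y .$$ -/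

import Mathlib

open scoped TensorProduct ComplexOrder ComplexConjugate

universe u v

namespace FinQG

noncomputable section

/-! ### Adjoints with respect to forms -/

/-- The adjoint of a linear map `T : V → W` with respect to forms `s` on `V` and `t` on `W`: the
linear map `T' : W → V` with `t (T v) w = s v (T' w)` for all `v`, `w`. It exists and is unique
when `V`, `W` are finite-dimensional and the forms (bilinear, or conjugate-linear in the first
variable) are non-degenerate, which is the only case in which it is used. -/
def adjointMap {V W : Type*} [AddCommGroup V] [Module ℂ V] [AddCommGroup W] [Module ℂ W]
    (s : V → V → ℂ) (t : W → W → ℂ) (T : V →ₗ[ℂ] W) : W →ₗ[ℂ] V :=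
  Classical.epsilon fun T' : W →ₗ[ℂ] V => ∀ v w, t (T v) w = s v (T' w)

/-! ### Frobenius `*`-algebras and finite quantum groups -/

/-- The functional `ψ` makes the `*`-algebra `A` a Frobenius `*`-algebra: it is positive and the
bilinear form `(a, b) ↦ ψ (a b)` is non-degenerate. -/
structure IsFrobenius {A : Type*} [Ring A] [Algebra ℂ A] [StarRing A] (ψ : A →ₗ[ℂ] ℂ) : Prop where
  nonneg : ∀ a : A, 0 ≤ ψ (star a * a)
  nondegenerate : ∀ a : A, (∀ b : A, ψ (a * b) = 0) → a = 0

/-- A finite quantum group `Γ`, given by `A = C(Γ)`: a finite-dimensional Hopf `*`-algebra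
(comultiplication and counit are `*`-homomorphisms) whose underlying `*`-algebra is a C*-algebra;
in finite dimension this means that it admits some Frobenius `*`-algebra structure, that is, some
positive functional which is faithful. -/
class FiniteQuantumGroup (A : Type*) [Ring A] [HopfAlgebra ℂ A] [StarRing A] [StarModule ℂ A] :
    Prop where
  finiteDimensional : FiniteDimensional ℂ A
  comul_star : ∀ a : A,
    Coalgebra.comul (R := ℂ) (star a) = star (Coalgebra.comul (R := ℂ) a : A ⊗[ℂ] A)
  counit_star : ∀ a : A,
    Coalgebra.counit (R := ℂ) (star a) = conj (Coalgebra.counit (R := ℂ) a : ℂ)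
  exists_isFrobenius : ∃ φ : A →ₗ[ℂ] ℂ, IsFrobenius φ

/-- The inner product `⟨a, b⟩ = ψ (a* b)` on `A`. -/
def innerOne {A : Type*} [Ring A] [Algebra ℂ A] [StarRing A] (ψ : A →ₗ[ℂ] ℂ) (a b : A) : ℂ :=
  ψ (star a * b)

/-- The inner product on `A ⊗ A`, `⟨a ⊗ b, c ⊗ d⟩ = ⟨a, c⟩ ⟨b, d⟩`. -/
def innerTwo {A : Type*} [Ring A] [Algebra ℂ A] [StarRing A] [StarModule ℂ A] (ψ : A →ₗ[ℂ] ℂ)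
    (x y : A ⊗[ℂ] A) : ℂ :=
  LinearMap.mul' ℂ ℂ (TensorProduct.map ψ ψ (star x * y))

/-- `m†`, the adjoint of the multiplication `m : A ⊗ A → A`. -/
def mulDagger {A : Type*} [Ring A] [Algebra ℂ A] [StarRing A] [StarModule ℂ A] (ψ : A →ₗ[ℂ] ℂ) :
    A →ₗ[ℂ] A ⊗[ℂ] A :=
  adjointMap (innerTwo ψ) (innerOne ψ) (LinearMap.mul' ℂ A)

/-- `Δ†`, the adjoint of the comultiplication. -/
def comulDagger {A : Type*} [Ring A] [HopfAlgebra ℂ A] [StarRing A] [StarModule ℂ A]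
    (ψ : A →ₗ[ℂ] ℂ) : A ⊗[ℂ] A →ₗ[ℂ] A :=
  adjointMap (innerOne ψ) (innerTwo ψ) (Coalgebra.comul (R := ℂ) (A := A))

/-- `ε†`, the adjoint of the counit `ε : A → ℂ`, as an element of `A`. -/
def counitDagger {A : Type*} [Ring A] [HopfAlgebra ℂ A] [StarRing A]
    (ψ : A →ₗ[ℂ] ℂ) : A :=
  adjointMap (innerOne ψ) (fun z w : ℂ => conj z * w) (Coalgebra.counit (R := ℂ) (A := A)) 1

/-- `ψ` is the normalized Haar functional: a positive left-invariant functional which makes `A` a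
special (`m m† = id`) symmetric Frobenius `*`-algebra. -/
structure IsHaar {A : Type*} [Ring A] [HopfAlgebra ℂ A] [StarRing A] [StarModule ℂ A]
    (ψ : A →ₗ[ℂ] ℂ) : Prop extends IsFrobenius ψ where
  leftInvariant : ∀ a : A,
    TensorProduct.lid ℂ A (ψ.rTensor A (Coalgebra.comul (R := ℂ) a)) = ψ a • (1 : A)
  symmetric : ∀ a b : A, ψ (a * b) = ψ (b * a)
  special : LinearMap.mul' ℂ A ∘ₗ mulDagger ψ = LinearMap.id

/-- The normalized Haar functional `η†` of a finite quantum group. -/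
def haar (A : Type*) [Ring A] [HopfAlgebra ℂ A] [StarRing A] [StarModule ℂ A] : A →ₗ[ℂ] ℂ :=
  Classical.epsilon fun ψ : A →ₗ[ℂ] ℂ => IsHaar ψ

/-! ### The operations on `l²(Γ)`

The product `x • y` is the product of `A` and `x*` is `star x`. -/

/-- The convolution `x * y = Δ†(x ⊗ y)`, with `†` taken for the inner product given by `ψ`. -/
def conv {A : Type*} [Ring A] [HopfAlgebra ℂ A] [StarRing A] [StarModule ℂ A]
    (ψ : A →ₗ[ℂ] ℂ) (x y : A) : A :=
  comulDagger ψ (x ⊗ₜ[ℂ] y)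

/-- The second involution `x⋆ = S (x*)`. -/
def convStar {A : Type*} [Ring A] [HopfAlgebra ℂ A] [StarRing A] (x : A) : A :=
  HopfAlgebra.antipode ℂ (star x)

/-- `Φ : C(Γ) → C(Γ̂)` is the Fourier transform onto a dual `Γ̂` of `Γ`: it identifies the Hopf
`*`-algebra `B = C(Γ̂)` with the dual `ℂΓ` of `A = C(Γ)`, which is the vector space `A` with
multiplication `Δ†`, unit `ε†`, comultiplication `m†`, counit `η†`, antipode `S` and
involution `⋆`. -/
structure IsFourierTransform {A : Type*} [Ring A] [HopfAlgebra ℂ A] [StarRing A] [StarModule ℂ A]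
    {B : Type*} [Ring B] [HopfAlgebra ℂ B] [StarRing B] [StarModule ℂ B] (Φ : A ≃ₗ[ℂ] B) :
    Prop where
  map_mul : ∀ x y : A, Φ (conv (haar A) x y) = Φ x * Φ y
  map_one : Φ (counitDagger (haar A)) = 1
  map_comul : ∀ x : A, Coalgebra.comul (R := ℂ) (Φ x) =
    TensorProduct.map Φ.toLinearMap Φ.toLinearMap (mulDagger (haar A) x)
  map_counit : ∀ x : A, Coalgebra.counit (R := ℂ) (Φ x) = haar A x
  map_antipode : ∀ x : A, HopfAlgebra.antipode ℂ (Φ x) = Φ (HopfAlgebra.antipode ℂ x)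
  map_star : ∀ x : A, star (Φ x) = Φ (convStar x)

/-! ### Tensors `l²(Γ)^{⊗k} → l²(Γ)^{⊗l}` -/

/-- The conjugate-linear map `x₁ ⊗ ⋯ ⊗ xₖ ↦ x₁* ⊗ ⋯ ⊗ xₖ*`. -/
def powStar {A : Type*} [Ring A] [Algebra ℂ A] [StarRing A] [StarModule ℂ A] (k : ℕ) :
    (⨂[ℂ]^k A) →+ (⨂[ℂ]^k A) :=
  PiTensorProduct.liftAddHom
    (fun p : ℂ × (Fin k → A) => conj p.1 • PiTensorProduct.tprod ℂ (star p.2))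
    (fun r f i hf => by
      have h : (PiTensorProduct.tprod ℂ (star f) : ⨂[ℂ]^k A) = 0 :=
        (PiTensorProduct.tprod ℂ).map_coord_zero i (by simp [hf])
      simp [h])
    (fun f => by simp)
    (fun r f i a b => by
      have e : ∀ c : A, star (Function.update f i c) = Function.update (star f) i (star c) := by
        intro c; ext j; by_cases h : j = i
        · subst h; simp
        · simp [h]
      simp only [e, star_add, MultilinearMap.map_update_add, smul_add])
    (fun r r' f => by simp [add_smul])
    (fun r f i r' => by
      have e : star (Function.update f i (r' • f i)) =
          Function.update (star f) i (conj r' • (star f) i) := by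
        ext j; by_cases h : j = i
        · subst h; simp
        · simp [h]
      simp only [e, MultilinearMap.map_update_smul, Function.update_eq_self, map_mul, smul_smul]
      rw [mul_comm])

theorem powStar_tprod {A : Type*} [Ring A] [Algebra ℂ A] [StarRing A] [StarModule ℂ A] (k : ℕ)
    (x : Fin k → A) :
    powStar k (PiTensorProduct.tprod ℂ x : ⨂[ℂ]^k A) = PiTensorProduct.tprod ℂ (star x) := by
  rw [PiTensorProduct.tprod_eq_tprodCoeff_one]
  change conj (1 : ℂ) • PiTensorProduct.tprod ℂ (star x) = _
  simp

/-- The functional `ψ ⊗ ⋯ ⊗ ψ` on `A^{⊗k}`. -/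
def powFunctional {A : Type*} [Ring A] [Algebra ℂ A] (ψ : A →ₗ[ℂ] ℂ) (k : ℕ) :
    (⨂[ℂ]^k A) →ₗ[ℂ] ℂ :=
  PiTensorProduct.lift
    ((MultilinearMap.mkPiAlgebra ℂ (Fin k) ℂ).compLinearMap fun _ => ψ)

/-- The inner product on `A^{⊗k}`: `⟨x₁ ⊗ ⋯ ⊗ xₖ, y₁ ⊗ ⋯ ⊗ yₖ⟩ = ∏ ψ (xᵢ* yᵢ)`. -/
def powInner {A : Type*} [Ring A] [Algebra ℂ A] [StarRing A] [StarModule ℂ A]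
    (ψ : A →ₗ[ℂ] ℂ) (k : ℕ) (x y : ⨂[ℂ]^k A) : ℂ :=
  powFunctional ψ k (powStar k x * y)

/-- The nested bilinear form on `A^{⊗k}`: `βₖ(x₁ ⊗ ⋯ ⊗ xₖ, y₁ ⊗ ⋯ ⊗ yₖ) = ∏ ψ (xₖ₊₁₋ᵢ yᵢ)`. -/
def powBilin {A : Type*} [Ring A] [Algebra ℂ A]
    (ψ : A →ₗ[ℂ] ℂ) (k : ℕ) (x y : ⨂[ℂ]^k A) : ℂ :=
  powFunctional ψ k (PiTensorProduct.reindex ℂ (fun _ => A) Fin.revPerm x * y)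

theorem powInner_tprod {A : Type*} [Ring A] [Algebra ℂ A] [StarRing A] [StarModule ℂ A]
    (ψ : A →ₗ[ℂ] ℂ) (k : ℕ) (x y : Fin k → A) :
    powInner ψ k (PiTensorProduct.tprod ℂ x) (PiTensorProduct.tprod ℂ y) =
      ∏ i, ψ (star (x i) * y i) := by
  simp [powInner, powFunctional, powStar_tprod]

theorem powBilin_tprod {A : Type*} [Ring A] [Algebra ℂ A]
    (ψ : A →ₗ[ℂ] ℂ) (k : ℕ) (x y : Fin k → A) :
    powBilin ψ k (PiTensorProduct.tprod ℂ x) (PiTensorProduct.tprod ℂ y) =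
      ∏ i, ψ (x (Fin.rev i) * y i) := by
  unfold powBilin powFunctional
  erw [PiTensorProduct.reindex_tprod, PiTensorProduct.tprod_mul_tprod]
  simp

/-- `T†`, the adjoint of a tensor for the inner products. -/
def dagger {A : Type*} [Ring A] [Algebra ℂ A] [StarRing A] [StarModule ℂ A]
    (ψ : A →ₗ[ℂ] ℂ) {k l : ℕ} (T : (⨂[ℂ]^k A) →ₗ[ℂ] ⨂[ℂ]^l A) : (⨂[ℂ]^l A) →ₗ[ℂ] ⨂[ℂ]^k A :=
  adjointMap (powInner ψ k) (powInner ψ l) T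

/-- `Tᵀ`, the categorical transpose: the adjoint of a tensor for the nested bilinear forms. -/
def transpose {A : Type*} [Ring A] [Algebra ℂ A]
    (ψ : A →ₗ[ℂ] ℂ) {k l : ℕ} (T : (⨂[ℂ]^k A) →ₗ[ℂ] ⨂[ℂ]^l A) : (⨂[ℂ]^l A) →ₗ[ℂ] ⨂[ℂ]^k A :=
  adjointMap (powBilin ψ k) (powBilin ψ l) T

/-- `T* = (T†)ᵀ`. -/
def conjugate {A : Type*} [Ring A] [Algebra ℂ A] [StarRing A] [StarModule ℂ A]
    (ψ : A →ₗ[ℂ] ℂ) {k l : ℕ} (T : (⨂[ℂ]^k A) →ₗ[ℂ] ⨂[ℂ]^l A) : (⨂[ℂ]^k A) →ₗ[ℂ] ⨂[ℂ]^l A :=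
  transpose ψ (dagger ψ T)

/-- `S^{⊗k}`. -/
def powAntipode (B : Type*) [Ring B] [HopfAlgebra ℂ B] (k : ℕ) : (⨂[ℂ]^k B) →ₗ[ℂ] ⨂[ℂ]^k B :=
  PiTensorProduct.map fun _ => HopfAlgebra.antipode ℂ (A := B)

/-- The transform `T̂ = Φ^{⊗l} T (Φ⁻¹)^{⊗k}` of a tensor. -/
def hat {A : Type*} [Ring A] [Algebra ℂ A] {B : Type*} [Ring B] [Algebra ℂ B] (Φ : A ≃ₗ[ℂ] B)
    {k l : ℕ} (T : (⨂[ℂ]^k A) →ₗ[ℂ] ⨂[ℂ]^l A) : (⨂[ℂ]^k B) →ₗ[ℂ] ⨂[ℂ]^l B :=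
  (PiTensorProduct.map fun _ => Φ.toLinearMap) ∘ₗ T ∘ₗ
    (PiTensorProduct.map fun _ => Φ.symm.toLinearMap)

end

end FinQG

/-! Everything follows from identifying the normalized Haar functional with the trace `regularTrace`
of the left regular representation, and from computing one functional on the dual.

Let ψ be a symmetric Frobenius functional with orthonormal basis bᵢ, and put w = ∑ bᵢ bᵢ*. Then m m†
is left multiplication by w, and the regular trace of x is ψ(w x). So ψ is special exactly when w =
1, that is, when ψ is the regular trace; this gives uniqueness. The regular trace is itself
positive, faithful and symmetric, hence special. It is invariant because the regular representation
absorbs tensor products, (tr ⊗ tr)Δ = n tr, which forces Δ(b) - b ⊗ 1 to have norm zero for b = (id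
⊗ tr)Δ(a) (`regularTrace_rightInvariant`).

By non-degeneracy ε = ψ(· Λ) for some Λ, which is a self-adjoint two-sided integral. Slicing Δ(Λ) on
either side recovers the antipode, and comparing the two formulas gives ψ(S(a) b) = ψ(a S(b))
(`haar_antipode_mul`). Hence ψ ∘ S = ψ, S² = id, and S commutes with the involution.

A dual is the space of functionals on A, with Fourier transform x ↦ ψ(· x). For any dual, ω = ε ∘
Φ⁻¹ satisfies ω(x̂ ŷ) = ψ(S(x) y) (`counitFunctional_mul`). It is left invariant with ω(1) = 1, so
the Haar functional of the dual is n ω. Since x⋆ = S(x*), the inner product of ω is exactly that of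
ψ, while its bilinear form is that of ψ twisted by S. For a functional c ω, the forms on the k-th
tensor power pick up c ^ k. Adjoints and transposes of maps from the k-th to the l-th power
therefore differ by powers of c with exponent ±(k - l), and transposes also by antipodes. Taking c =
n and c = n⁻¹ gives the two sets of formulas. -/

namespace FinQG

/-! ### Positive functionals and orthonormal bases -/

section Frobenius

variable {A : Type*} [Ring A] [Algebra ℂ A] [StarRing A] [StarModule ℂ A] {ψ : A →ₗ[ℂ] ℂ}

/-- Polarization: ψ(c* c) is real for c = 1, a, 1 + a and 1 + i a. -/
theorem IsFrobenius.map_star (h : IsFrobenius ψ) (a : A) : ψ (star a) = conj (ψ a) := by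
  have hreal : ∀ c : A, (ψ (star c * c)).im = 0 := fun c => by
    have := (Complex.le_def.1 (h.nonneg c)).2
    simpa using this.symm
  have h1 := hreal (1 + a)
  have h2 := hreal (1 + Complex.I • a)
  have h0 := hreal a
  have h00 := hreal (1 : A)
  simp only [star_add, star_one, star_smul, add_mul, mul_add, one_mul, mul_one, map_add,
    smul_mul_assoc, mul_smul_comm, map_smul, smul_eq_mul, Complex.add_im] at h1 h2 h00
  simp only [Complex.star_def, Complex.conj_I, Complex.mul_im, Complex.neg_re, Complex.neg_im,
    Complex.I_re, Complex.I_im, Complex.mul_re] at h2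
  apply Complex.ext <;> simp <;> linarith

/-- By Cauchy–Schwarz, ψ(a* a) = 0 forces ψ(a* b) = 0 for all b, so non-degeneracy upgrades to
faithfulness. -/
theorem IsFrobenius.eq_zero_of_apply_eq_zero (h : IsFrobenius ψ) {a : A}
    (ha : ψ (star a * a) = 0) : a = 0 := by
  let core : PreInnerProductSpace.Core ℂ A :=
    { inner := fun x y => ψ (star x * y)
      conj_inner_symm := fun x y => by rw [← h.map_star]; simp
      re_inner_nonneg := fun x => (Complex.le_def.1 (h.nonneg x)).1
      add_left := fun x y z => by simp [add_mul]
      smul_left := fun x y r => by simp }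
  rw [← star_eq_zero]
  refine h.nondegenerate _ fun b => ?_
  have := @InnerProductSpace.Core.inner_mul_inner_self_le ℂ A _ _ _ core b a
  rw [@InnerProductSpace.Core.norm_inner_symm ℂ A _ _ _ core b a] at this
  change ‖ψ (star a * b)‖ * ‖ψ (star a * b)‖ ≤
    Complex.re (ψ (star b * b)) * Complex.re (ψ (star a * a)) at this
  rw [ha] at this
  simp only [Complex.zero_re, mul_zero] at this
  have h3 := mul_self_eq_zero.1 (le_antisymm this (mul_self_nonneg _))
  exact norm_eq_zero.1 h3

omit [StarModule ℂ A] in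
theorem IsFrobenius.of_pos (hpos : ∀ a : A, 0 ≤ ψ (star a * a))
    (hdef : ∀ a : A, ψ (star a * a) = 0 → a = 0) : IsFrobenius ψ :=
  ⟨hpos, fun a ha => star_eq_zero.1 (hdef _ (by simpa using ha (star a)))⟩

/-- A basis which is orthonormal for the inner product of a positive functional. -/
def IsOrthonormalFor {ι : Type*} [DecidableEq ι] (ψ : A →ₗ[ℂ] ℂ) (b : Module.Basis ι ℂ A) : Prop :=
  ∀ i j, ψ (star (b i) * b j) = if i = j then 1 else 0

theorem IsFrobenius.exists_orthonormal [FiniteDimensional ℂ A] (h : IsFrobenius ψ) :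
    ∃ b : Module.Basis (Fin (Module.finrank ℂ A)) ℂ A, IsOrthonormalFor ψ b := by
  let core : InnerProductSpace.Core ℂ A :=
    { inner := fun x y => ψ (star x * y)
      conj_inner_symm := fun x y => by rw [← h.map_star]; simp
      re_inner_nonneg := fun x => (Complex.le_def.1 (h.nonneg x)).1
      add_left := fun x y z => by simp [add_mul]
      smul_left := fun x y r => by simp
      definite := fun x hx => h.eq_zero_of_apply_eq_zero hx }
  let _ : NormedAddCommGroup A := core.toNormedAddCommGroup
  let _ : InnerProductSpace ℂ A := InnerProductSpace.ofCore core.toCore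
  exact ⟨(stdOrthonormalBasis ℂ A).toBasis, fun i j => by
    have := (orthonormal_iff_ite.1 (stdOrthonormalBasis ℂ A).orthonormal) i j
    rw [OrthonormalBasis.coe_toBasis]
    exact this⟩

section Basis

variable {ι : Type*} [DecidableEq ι] [Fintype ι] {b : Module.Basis ι ℂ A}

omit [StarModule ℂ A] in
theorem IsOrthonormalFor.repr_apply (hb : IsOrthonormalFor ψ b) (x : A) (i : ι) :
    b.repr x i = ψ (star (b i) * x) := by
  have := congrArg (fun y => ψ (star (b i) * y)) (b.sum_repr x)
  refine Eq.trans ?_ this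
  simp only [Finset.mul_sum, mul_smul_comm, map_sum, map_smul, hb i]
  simp

omit [StarModule ℂ A] in
theorem IsOrthonormalFor.sum_apply_smul (hb : IsOrthonormalFor ψ b) (x : A) :
    ∑ i, ψ (star (b i) * x) • b i = x := by
  simp_rw [← hb.repr_apply]
  exact b.sum_repr x

theorem IsOrthonormalFor.sum_apply_smul_star (h : IsFrobenius ψ) (hb : IsOrthonormalFor ψ b)
    (x : A) : ∑ i, ψ (x * b i) • star (b i) = x := by
  have := congrArg star (hb.sum_apply_smul (star x))
  simpa [star_sum, ← h.map_star] using this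

omit [StarModule ℂ A] in
theorem IsOrthonormalFor.trace_eq (hb : IsOrthonormalFor ψ b) (T : A →ₗ[ℂ] A) :
    LinearMap.trace ℂ A T = ∑ i, ψ (star (b i) * T (b i)) := by
  rw [LinearMap.trace_eq_matrix_trace ℂ b, Matrix.trace]
  simp [LinearMap.toMatrix_apply, hb.repr_apply]

end Basis

/-- The functional `ψ ⊗ ψ` on `A ⊗ A`. -/
noncomputable def tensorFunctional (ψ : A →ₗ[ℂ] ℂ) : A ⊗[ℂ] A →ₗ[ℂ] ℂ :=
  LinearMap.mul' ℂ ℂ ∘ₗ TensorProduct.map ψ ψ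

omit [StarRing A] [StarModule ℂ A] in
@[simp]
theorem tensorFunctional_tmul (ψ : A →ₗ[ℂ] ℂ) (x y : A) :
    tensorFunctional ψ (x ⊗ₜ y) = ψ x * ψ y := rfl

theorem innerTwo_eq (x y : A ⊗[ℂ] A) : innerTwo ψ x y = tensorFunctional ψ (star x * y) := rfl

/-- Expanding the first leg in an orthonormal basis, X = ∑ bᵢ ⊗ yᵢ, turns (ψ ⊗ ψ)(X* X) into ∑ ψ(yᵢ*
yᵢ). -/
theorem IsFrobenius.tensor [FiniteDimensional ℂ A] (h : IsFrobenius ψ) :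
    IsFrobenius (tensorFunctional ψ) := by
  classical
  obtain ⟨b, hb⟩ := h.exists_orthonormal
  have key : ∀ X : A ⊗[ℂ] A, ∃ y : Fin (Module.finrank ℂ A) → A, X = ∑ i, b i ⊗ₜ[ℂ] y i := by
    intro X
    induction X with
    | zero => exact ⟨0, by simp⟩
    | tmul x y =>
      refine ⟨fun i => b.repr x i • y, ?_⟩
      conv_lhs => rw [← b.sum_repr x, TensorProduct.sum_tmul]
      simp [TensorProduct.smul_tmul]
    | add X Y hX hY =>
      obtain ⟨x, rfl⟩ := hX
      obtain ⟨y, rfl⟩ := hY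
      exact ⟨x + y, by simp [TensorProduct.tmul_add, Finset.sum_add_distrib]⟩
  have val : ∀ y : Fin (Module.finrank ℂ A) → A,
      tensorFunctional ψ (star (∑ i, b i ⊗ₜ[ℂ] y i) * ∑ i, b i ⊗ₜ[ℂ] y i) =
        ∑ i, ψ (star (y i) * y i) := by
    intro y
    simp only [star_sum, TensorProduct.star_tmul, Finset.sum_mul, Finset.mul_sum,
      Algebra.TensorProduct.tmul_mul_tmul, map_sum, tensorFunctional_tmul]
    simp [hb _ _]
  refine IsFrobenius.of_pos (fun X => ?_) (fun X hX => ?_)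
  · obtain ⟨y, rfl⟩ := key X
    rw [val]
    exact Finset.sum_nonneg fun i _ => h.nonneg _
  · obtain ⟨y, rfl⟩ := key X
    rw [val, Finset.sum_eq_zero_iff_of_nonneg fun i _ => h.nonneg _] at hX
    refine Finset.sum_eq_zero fun i hi => ?_
    rw [h.eq_zero_of_apply_eq_zero (hX i hi), TensorProduct.tmul_zero]

end Frobenius

/-! ### Existence and uniqueness of adjoints -/

section Adjoint

/-- Separation in the second variable leaves only one candidate, so the choice made in `adjointMap`
is forced. -/
theorem adjointMap_eq {V W : Type*} [AddCommGroup V] [Module ℂ V] [AddCommGroup W] [Module ℂ W]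
    {s : V → V → ℂ} {t : W → W → ℂ} {T : V →ₗ[ℂ] W} {T' : W →ₗ[ℂ] V}
    (hs : ∀ w w', (∀ v, s v w = s v w') → w = w')
    (hT : ∀ v w, t (T v) w = s v (T' w)) : adjointMap s t T = T' := by
  have := Classical.epsilon_spec (p := fun T' : W →ₗ[ℂ] V => ∀ v w, t (T v) w = s v (T' w)) ⟨T', hT⟩
  ext w
  exact hs _ _ fun v => (this v w).symm.trans (hT v w)

/-- In finite dimension a non-degenerate form identifies V with its dual, so the dual map of T can
be transported back. -/
theorem exists_adjoint {V W : Type*} [AddCommGroup V] [Module ℂ V] [FiniteDimensional ℂ V]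
    [AddCommGroup W] [Module ℂ W] (β : V →ₗ[ℂ] V →ₗ[ℂ] ℂ) (γ : W →ₗ[ℂ] W →ₗ[ℂ] ℂ)
    (hβ : ∀ w, (∀ v, β v w = 0) → w = 0) (T : V →ₗ[ℂ] W) :
    ∃ T' : W →ₗ[ℂ] V, ∀ v w, γ (T v) w = β v (T' w) := by
  have hinj : Function.Injective β.flip := by
    rw [← LinearMap.ker_eq_bot, LinearMap.ker_eq_bot']
    exact fun w hw => hβ w fun v => LinearMap.congr_fun hw v
  let e := LinearEquiv.ofInjectiveOfFinrankEq β.flip hinj Subspace.dual_finrank_eq.symm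
  refine ⟨e.symm.toLinearMap ∘ₗ T.dualMap ∘ₗ γ.flip, fun v w => ?_⟩
  have : β.flip (e.symm (T.dualMap (γ.flip w))) = T.dualMap (γ.flip w) :=
    e.apply_symm_apply _
  exact (LinearMap.congr_fun this v).symm

end Adjoint

/-! ### The regular trace as the special symmetric Frobenius functional -/

section Trace

variable {A : Type*} [Ring A] [Algebra ℂ A]

variable (A) in
/-- The trace of the left regular representation. -/
noncomputable def regularTrace : A →ₗ[ℂ] ℂ := LinearMap.trace ℂ A ∘ₗ LinearMap.mul ℂ A

theorem regularTrace_apply (a : A) :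
    regularTrace A a = LinearMap.trace ℂ A (LinearMap.mulLeft ℂ a) := rfl

theorem regularTrace_mul_comm (a b : A) : regularTrace A (a * b) = regularTrace A (b * a) := by
  simp only [regularTrace_apply, LinearMap.mulLeft_mul]
  exact LinearMap.trace_mul_comm ℂ _ _

variable [StarRing A] [StarModule ℂ A] [FiniteDimensional ℂ A]

/-- The trace of a* a is the squared Hilbert–Schmidt norm of left multiplication by a, computed in
an orthonormal basis for φ. -/
theorem IsFrobenius.isFrobenius_regularTrace {φ : A →ₗ[ℂ] ℂ} (h : IsFrobenius φ) :
    IsFrobenius (regularTrace A) := by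
  obtain ⟨b, hb⟩ := h.exists_orthonormal
  have val : ∀ a : A, regularTrace A (star a * a) = ∑ i, φ (star (a * b i) * (a * b i)) := by
    intro a
    rw [regularTrace_apply, hb.trace_eq]
    simp [mul_assoc]
  refine IsFrobenius.of_pos (fun a => ?_) fun a ha => ?_
  · rw [val]
    exact Finset.sum_nonneg fun i _ => h.nonneg _
  · rw [val, Finset.sum_eq_zero_iff_of_nonneg fun i _ => h.nonneg _] at ha
    have : LinearMap.mulLeft ℂ a = 0 := b.ext fun i => by
      simpa using h.eq_zero_of_apply_eq_zero (ha i (Finset.mem_univ i))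
    simpa using LinearMap.congr_fun this 1

/-- Pairing with p ⊗ q reduces the formula to the expansion p* = ∑ ψ(p* bᵢ) bᵢ*. -/
theorem mulDagger_apply {ι : Type*} [Fintype ι] [DecidableEq ι] {ψ : A →ₗ[ℂ] ℂ}
    (h : IsFrobenius ψ) {b : Module.Basis ι ℂ A} (hb : IsOrthonormalFor ψ b) (x : A) :
    mulDagger ψ x = ∑ i, b i ⊗ₜ[ℂ] (star (b i) * x) := by
  have : mulDagger ψ =
      ∑ i, TensorProduct.mk ℂ A A (b i) ∘ₗ LinearMap.mulLeft ℂ (star (b i)) := by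
    refine adjointMap_eq (fun X Y hXY => ?_) fun X y => ?_
    · rw [← sub_eq_zero]
      refine h.tensor.eq_zero_of_apply_eq_zero ?_
      have := hXY (X - Y)
      rw [innerTwo_eq, innerTwo_eq, ← sub_eq_zero, ← map_sub, ← mul_sub] at this
      exact this
    · induction X with
      | zero => simp [innerOne, innerTwo]
      | add X Y hX hY =>
        simp only [innerOne, innerTwo_eq, map_add, star_add, add_mul] at hX hY ⊢
        rw [hX, hY]
      | tmul p q =>
        simp only [innerOne, innerTwo_eq, LinearMap.mul'_apply, star_mul, LinearMap.sum_apply,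
          LinearMap.comp_apply, TensorProduct.mk_apply, LinearMap.mulLeft_apply,
          Finset.mul_sum, TensorProduct.star_tmul, Algebra.TensorProduct.tmul_mul_tmul, map_sum,
          tensorFunctional_tmul]
        conv_lhs => rw [← hb.sum_apply_smul_star h (star p)]
        simp [Finset.sum_mul, Finset.mul_sum, mul_assoc]
  rw [this]
  simp

theorem mul_mulDagger_apply {ι : Type*} [Fintype ι] [DecidableEq ι] {ψ : A →ₗ[ℂ] ℂ}
    (h : IsFrobenius ψ) {b : Module.Basis ι ℂ A} (hb : IsOrthonormalFor ψ b) (x : A) :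
    LinearMap.mul' ℂ A (mulDagger ψ x) = (∑ i, b i * star (b i)) * x := by
  rw [mulDagger_apply h hb]
  simp [Finset.sum_mul, mul_assoc]

omit [StarModule ℂ A] [FiniteDimensional ℂ A] in
theorem regularTrace_eq_apply_mul_sum {ι : Type*} [Fintype ι] [DecidableEq ι] {ψ : A →ₗ[ℂ] ℂ}
    (hs : ∀ a b, ψ (a * b) = ψ (b * a)) {b : Module.Basis ι ℂ A} (hb : IsOrthonormalFor ψ b)
    (x : A) : regularTrace A x = ψ ((∑ i, b i * star (b i)) * x) := by
  rw [regularTrace_apply, hb.trace_eq, Finset.sum_mul, map_sum]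
  refine Finset.sum_congr rfl fun i _ => ?_
  rw [LinearMap.mulLeft_apply, hs, mul_assoc, hs, mul_assoc]

/-- Applied to the regular trace itself, `regularTrace_eq_apply_mul_sum` reads tr(x) = tr(w x) for
all x, so w = 1 by non-degeneracy. -/
theorem mul_mulDagger_regularTrace {φ : A →ₗ[ℂ] ℂ} (h : IsFrobenius φ) :
    LinearMap.mul' ℂ A ∘ₗ mulDagger (regularTrace A) = LinearMap.id := by
  obtain ⟨b, hb⟩ := h.isFrobenius_regularTrace.exists_orthonormal
  have : ∑ i, b i * star (b i) = 1 := by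
    rw [← sub_eq_zero]
    refine h.isFrobenius_regularTrace.nondegenerate _ fun x => ?_
    rw [sub_mul, map_sub, ← regularTrace_eq_apply_mul_sum regularTrace_mul_comm hb, one_mul, sub_self]
  ext x
  simp [mul_mulDagger_apply h.isFrobenius_regularTrace hb, this]

theorem IsFrobenius.eq_regularTrace {ψ : A →ₗ[ℂ] ℂ} (h : IsFrobenius ψ)
    (hs : ∀ a b, ψ (a * b) = ψ (b * a))
    (hm : LinearMap.mul' ℂ A ∘ₗ mulDagger ψ = LinearMap.id) : ψ = regularTrace A := by
  obtain ⟨b, hb⟩ := h.exists_orthonormal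
  ext x
  rw [regularTrace_eq_apply_mul_sum hs hb, ← mul_mulDagger_apply h hb]
  congr 1
  exact (LinearMap.congr_fun hm x).symm

end Trace

/-! ### Absorption of tensor products by the regular representation -/

section Hopf

variable {A : Type*} [Ring A] [HopfAlgebra ℂ A]

open Coalgebra

local notation "S" => HopfAlgebra.antipode ℂ (A := A)

/-- Coassociativity regroups the sum as S(a₁) a₂ ⊗ a₃, where the antipode axiom collapses the first
leg. -/
theorem sum_antipode_mul_comul (a : A) (𝓡 : Repr ℂ a (A × A)) :
    ∑ i ∈ 𝓡.index, (S (𝓡.left i) ⊗ₜ[ℂ] (1 : A)) * comul (R := ℂ) (𝓡.right i) = 1 ⊗ₜ a := by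
  let G : A ⊗[ℂ] A →ₗ[ℂ] A := LinearMap.mul' ℂ A ∘ₗ LinearMap.rTensor A S
  let F : A ⊗[ℂ] (A ⊗[ℂ] A) →ₗ[ℂ] A ⊗[ℂ] A :=
    LinearMap.rTensor A G ∘ₗ (TensorProduct.assoc ℂ A A A).symm.toLinearMap
  have hF : ∀ (x : A) (Y : A ⊗[ℂ] A), F (x ⊗ₜ Y) = (S x ⊗ₜ[ℂ] (1 : A)) * Y := by
    intro x Y
    induction Y with
    | zero => simp
    | add X Y hX hY => rw [TensorProduct.tmul_add, map_add, hX, hY, mul_add]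
    | tmul y z => simp [F, G]
  have h1 : ∑ i ∈ 𝓡.index, (S (𝓡.left i) ⊗ₜ[ℂ] (1 : A)) * comul (R := ℂ) (𝓡.right i) =
      F (LinearMap.lTensor A comul (comul (R := ℂ) a)) := by
    rw [← 𝓡.eq]
    simp [hF]
  rw [h1, ← coassoc_apply]
  simp only [F, LinearMap.comp_apply, LinearEquiv.coe_coe, LinearEquiv.symm_apply_apply]
  rw [← LinearMap.rTensor_comp_apply]
  have h2 : G ∘ₗ comul = Algebra.linearMap ℂ A ∘ₗ counit := by
    ext x; simp [G]
  rw [h2, LinearMap.rTensor_comp_apply, rTensor_counit_comul]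
  simp

theorem sum_comul_mul_antipode (a : A) (𝓡 : Repr ℂ a (A × A)) :
    ∑ i ∈ 𝓡.index, comul (R := ℂ) (𝓡.left i) * ((1 : A) ⊗ₜ[ℂ] S (𝓡.right i)) = a ⊗ₜ 1 := by
  let G : A ⊗[ℂ] A →ₗ[ℂ] A := LinearMap.mul' ℂ A ∘ₗ LinearMap.lTensor A S
  let F : (A ⊗[ℂ] A) ⊗[ℂ] A →ₗ[ℂ] A ⊗[ℂ] A :=
    LinearMap.lTensor A G ∘ₗ (TensorProduct.assoc ℂ A A A).toLinearMap
  have hF : ∀ (x : A) (Y : A ⊗[ℂ] A), F (Y ⊗ₜ x) = Y * ((1 : A) ⊗ₜ[ℂ] S x) := by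
    intro x Y
    induction Y with
    | zero => simp
    | add X Y hX hY => rw [TensorProduct.add_tmul, map_add, hX, hY, add_mul]
    | tmul y z => simp [F, G]
  have h1 : ∑ i ∈ 𝓡.index, comul (R := ℂ) (𝓡.left i) * ((1 : A) ⊗ₜ[ℂ] S (𝓡.right i)) =
      F (LinearMap.rTensor A comul (comul (R := ℂ) a)) := by
    rw [← 𝓡.eq]
    simp [hF]
  rw [h1]
  simp only [F, LinearMap.comp_apply, LinearEquiv.coe_coe]
  rw [coassoc_apply, ← LinearMap.lTensor_comp_apply]
  have h2 : G ∘ₗ comul = Algebra.linearMap ℂ A ∘ₗ counit := by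
    ext x; simp [G]
  rw [h2, LinearMap.lTensor_comp_apply, lTensor_counit_comul]
  simp

/-- The convolution square of the trace of the regular representation is a multiple of it, since
the regular representation absorbs tensor products. -/
theorem tensorFunctional_regularTrace_comul [FiniteDimensional ℂ A] (a : A) :
    tensorFunctional (regularTrace A) (comul (R := ℂ) a) =
      Module.finrank ℂ A * regularTrace A a := by
  have h1 : ∀ X : A ⊗[ℂ] A, tensorFunctional (regularTrace A) X =
      LinearMap.trace ℂ _ (LinearMap.mulLeft ℂ X) := by
    intro X
    induction X with
    | zero => simp
    | add X Y hX hY => rw [map_add, hX, hY, ← map_add]; congr 1; ext; simp [add_mul]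
    | tmul x y =>
      have : LinearMap.mulLeft ℂ (x ⊗ₜ[ℂ] y) =
          TensorProduct.map (LinearMap.mulLeft ℂ x) (LinearMap.mulLeft ℂ y) := by ext; simp
      rw [this, LinearMap.trace_tensorProduct', tensorFunctional_tmul]
      rfl
  -- W : x ⊗ v ↦ Δ(x)(1 ⊗ v) has inverse V : x ⊗ v ↦ x₁ ⊗ S(x₂) v, and it intertwines left
  -- multiplication by a on the first leg with left multiplication by Δ(a). The trace of the latter
  -- is therefore tr(a) times n.
  let W : A ⊗[ℂ] A →ₗ[ℂ] A ⊗[ℂ] A :=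
    TensorProduct.lift ((LinearMap.mul ℂ (A ⊗[ℂ] A)).compl₁₂ comul (TensorProduct.mk ℂ A A 1))
  let V : A ⊗[ℂ] A →ₗ[ℂ] A ⊗[ℂ] A :=
    TensorProduct.lift ((LinearMap.mul ℂ (A ⊗[ℂ] A)).compl₁₂ (LinearMap.lTensor A S ∘ₗ comul)
      (TensorProduct.mk ℂ A A 1))
  have hW : ∀ X v, W (X * ((1 : A) ⊗ₜ v)) = W X * ((1 : A) ⊗ₜ v) := by
    intro X v
    induction X with
    | zero => simp
    | add X Y hX hY => simp only [add_mul, map_add, hX, hY]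
    | tmul x y => simp [W, mul_assoc]
  have hWV : W * V = 1 := by
    ext x v
    have : V (x ⊗ₜ v) = (∑ i ∈ (ℛ ℂ x).index, (ℛ ℂ x).left i ⊗ₜ S ((ℛ ℂ x).right i)) *
        ((1 : A) ⊗ₜ v) := by
      simp only [V, TensorProduct.lift.tmul, LinearMap.compl₁₂_apply, LinearMap.comp_apply]
      rw [← (ℛ ℂ x).eq]
      simp [Finset.sum_mul]
    have h3 : W (V (x ⊗ₜ v)) = x ⊗ₜ v := by
      rw [this, hW, map_sum]
      have : ∀ i, W ((ℛ ℂ x).left i ⊗ₜ S ((ℛ ℂ x).right i)) =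
        comul (R := ℂ) ((ℛ ℂ x).left i) * ((1 : A) ⊗ₜ[ℂ] S ((ℛ ℂ x).right i)) := fun i => rfl
      simp only [this, sum_comul_mul_antipode, Algebra.TensorProduct.tmul_mul_tmul, mul_one,
        one_mul]
    simpa using h3
  -- In finite dimension a one-sided inverse is two-sided.
  have hVW : V * W = 1 := mul_eq_one_comm.1 hWV
  have h4 : LinearMap.mulLeft ℂ (comul (R := ℂ) a) * W =
      W * LinearMap.rTensor A (LinearMap.mulLeft ℂ a) := by
    ext x v
    simp [W, mul_assoc]
  rw [h1, ← mul_one (LinearMap.mulLeft ℂ (comul (R := ℂ) a)), ← hWV, ← mul_assoc, h4,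
    LinearMap.trace_mul_comm, ← mul_assoc, hVW, one_mul, LinearMap.rTensor,
    LinearMap.trace_tensorProduct', LinearMap.trace_id, mul_comm]
  rfl

end Hopf

/-! ### Slice maps -/

section Invariance

variable {A : Type*} [Ring A] [Algebra ℂ A]

/-- The slice map `ψ ⊗ id`. -/
noncomputable def sliceLeft (ψ : A →ₗ[ℂ] ℂ) : A ⊗[ℂ] A →ₗ[ℂ] A :=
  (TensorProduct.lid ℂ A).toLinearMap ∘ₗ LinearMap.rTensor A ψ

/-- The slice map `id ⊗ ψ`. -/
noncomputable def sliceRight (ψ : A →ₗ[ℂ] ℂ) : A ⊗[ℂ] A →ₗ[ℂ] A :=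
  (TensorProduct.rid ℂ A).toLinearMap ∘ₗ LinearMap.lTensor A ψ

@[simp]
theorem sliceLeft_tmul (ψ : A →ₗ[ℂ] ℂ) (x y : A) : sliceLeft ψ (x ⊗ₜ y) = ψ x • y := by
  simp [sliceLeft]

@[simp]
theorem sliceRight_tmul (ψ : A →ₗ[ℂ] ℂ) (x y : A) : sliceRight ψ (x ⊗ₜ y) = ψ y • x := by
  simp [sliceRight]

theorem apply_mul_sliceRight (φ ψ : A →ₗ[ℂ] ℂ) (a b : A) (X : A ⊗[ℂ] A) :
    φ (a * sliceRight ψ X * b) =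
      LinearMap.mul' ℂ ℂ (TensorProduct.map φ ψ ((a ⊗ₜ 1) * X * (b ⊗ₜ 1))) := by
  induction X with
  | zero => simp
  | add X Y hX hY => simp only [map_add, mul_add, add_mul, hX, hY]
  | tmul x y => simp [mul_comm]

theorem apply_mul_sliceLeft (φ ψ : A →ₗ[ℂ] ℂ) (a b : A) (X : A ⊗[ℂ] A) :
    φ (a * sliceLeft ψ X * b) =
      LinearMap.mul' ℂ ℂ (TensorProduct.map ψ φ ((1 ⊗ₜ a) * X * (1 ⊗ₜ b))) := by
  induction X with
  | zero => simp
  | add X Y hX hY => simp only [map_add, mul_add, add_mul, hX, hY]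
  | tmul x y => simp

theorem sliceRight_mul (ψ : A →ₗ[ℂ] ℂ) (a b : A) (X : A ⊗[ℂ] A) :
    sliceRight ψ ((a ⊗ₜ 1) * X * (b ⊗ₜ 1)) = a * sliceRight ψ X * b := by
  induction X with
  | zero => simp
  | add X Y hX hY => simp only [map_add, mul_add, add_mul, hX, hY]
  | tmul x y => simp

theorem sliceLeft_mul (ψ : A →ₗ[ℂ] ℂ) (a b : A) (X : A ⊗[ℂ] A) :
    sliceLeft ψ ((1 ⊗ₜ a) * X * (1 ⊗ₜ b)) = a * sliceLeft ψ X * b := by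
  induction X with
  | zero => simp
  | add X Y hX hY => simp only [map_add, mul_add, add_mul, hX, hY]
  | tmul x y => simp

theorem sliceRight_star [StarRing A] [StarModule ℂ A] {ψ : A →ₗ[ℂ] ℂ} (h : IsFrobenius ψ)
    (X : A ⊗[ℂ] A) : sliceRight ψ (star X) = star (sliceRight ψ X) := by
  induction X with
  | zero => simp
  | add X Y hX hY => simp only [map_add, star_add, hX, hY]
  | tmul x y => simp [h.map_star]

theorem sliceLeft_star [StarRing A] [StarModule ℂ A] {ψ : A →ₗ[ℂ] ℂ} (h : IsFrobenius ψ)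
    (X : A ⊗[ℂ] A) : sliceLeft ψ (star X) = star (sliceLeft ψ X) := by
  induction X with
  | zero => simp
  | add X Y hX hY => simp only [map_add, star_add, hX, hY]
  | tmul x y => simp [h.map_star]

end Invariance

/-! ### Slices of the comultiplication and invariant functionals -/

section Hopf

open Coalgebra

variable {A : Type*} [Ring A] [HopfAlgebra ℂ A]

/-- By coassociativity, slicing twice is slicing once by the convolution square of ψ; for the
regular trace that square is n times the trace. -/
theorem sliceRight_comul_sliceRight_comul (ψ : A →ₗ[ℂ] ℂ) (a : A) :
    sliceRight ψ (comul (R := ℂ) (sliceRight ψ (comul (R := ℂ) a))) =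
      sliceRight (tensorFunctional ψ ∘ₗ comul (R := ℂ)) (comul (R := ℂ) a) := by
  let F : (A ⊗[ℂ] A) ⊗[ℂ] A →ₗ[ℂ] A :=
    TensorProduct.lift ((LinearMap.lsmul ℂ A).flip ∘ₗ sliceRight ψ) ∘ₗ
      LinearMap.lTensor (A ⊗[ℂ] A) ψ
  have h1 : ∀ X : A ⊗[ℂ] A, sliceRight ψ (comul (R := ℂ) (sliceRight ψ X)) =
      F (LinearMap.rTensor A comul X) := by
    intro X
    induction X with
    | zero => simp
    | add X Y hX hY => simp only [map_add, hX, hY]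
    | tmul x y => simp [F]
  have h2 : ∀ X : A ⊗[ℂ] (A ⊗[ℂ] A), F ((TensorProduct.assoc ℂ A A A).symm X) =
      (TensorProduct.rid ℂ A) (LinearMap.lTensor A (tensorFunctional ψ) X) := by
    intro X
    have : F ∘ₗ (TensorProduct.assoc ℂ A A A).symm.toLinearMap =
        (TensorProduct.rid ℂ A).toLinearMap ∘ₗ LinearMap.lTensor A (tensorFunctional ψ) := by
      ext x y z
      simp [F, smul_smul]
    exact LinearMap.congr_fun this X
  rw [h1, ← coassoc_symm_apply, h2, ← LinearMap.lTensor_comp_apply]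
  rfl

theorem sliceLeft_comul_sliceLeft_comul (ψ : A →ₗ[ℂ] ℂ) (a : A) :
    sliceLeft ψ (comul (R := ℂ) (sliceLeft ψ (comul (R := ℂ) a))) =
      sliceLeft (tensorFunctional ψ ∘ₗ comul (R := ℂ)) (comul (R := ℂ) a) := by
  let F : A ⊗[ℂ] (A ⊗[ℂ] A) →ₗ[ℂ] A :=
    TensorProduct.lift ((LinearMap.lsmul ℂ A).compl₁₂ LinearMap.id (sliceLeft ψ)) ∘ₗ
      LinearMap.rTensor (A ⊗[ℂ] A) ψ
  have h1 : ∀ X : A ⊗[ℂ] A, sliceLeft ψ (comul (R := ℂ) (sliceLeft ψ X)) =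
      F (LinearMap.lTensor A comul X) := by
    intro X
    induction X with
    | zero => simp
    | add X Y hX hY => simp only [map_add, hX, hY]
    | tmul x y => simp [F]
  have h2 : ∀ X : (A ⊗[ℂ] A) ⊗[ℂ] A, F ((TensorProduct.assoc ℂ A A A) X) =
      (TensorProduct.lid ℂ A) (LinearMap.rTensor A (tensorFunctional ψ) X) := by
    intro X
    have : F ∘ₗ (TensorProduct.assoc ℂ A A A).toLinearMap =
        (TensorProduct.lid ℂ A).toLinearMap ∘ₗ LinearMap.rTensor A (tensorFunctional ψ) := by
      ext x y z
      simp [F, smul_smul, mul_comm]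
    exact LinearMap.congr_fun this X
  rw [h1, ← coassoc_apply, h2, ← LinearMap.rTensor_comp_apply]
  rfl

theorem sliceRight_counit_comul (a : A) :
    sliceRight (counit (R := ℂ)) (comul (R := ℂ) a) = a := by
  simp [sliceRight]

theorem sliceLeft_counit_comul (a : A) :
    sliceLeft (counit (R := ℂ)) (comul (R := ℂ) a) = a := by
  simp [sliceLeft]

theorem counit_sliceRight_comul (ψ : A →ₗ[ℂ] ℂ) (a : A) :
    counit (R := ℂ) (sliceRight ψ (comul (R := ℂ) a)) = ψ a := by
  conv_rhs => rw [← sliceLeft_counit_comul a]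
  induction comul (R := ℂ) a with
  | zero => simp
  | add X Y hX hY => simp only [map_add, hX, hY]
  | tmul x y => simp [mul_comm]

theorem counit_sliceLeft_comul (ψ : A →ₗ[ℂ] ℂ) (a : A) :
    counit (R := ℂ) (sliceLeft ψ (comul (R := ℂ) a)) = ψ a := by
  conv_rhs => rw [← sliceRight_counit_comul a]
  induction comul (R := ℂ) a with
  | zero => simp
  | add X Y hX hY => simp only [map_add, hX, hY]
  | tmul x y => simp [mul_comm]

theorem eq_of_comul_eq_tmul_one {b : A} (h : comul (R := ℂ) b = b ⊗ₜ[ℂ] 1) :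
    b = counit (R := ℂ) b • 1 := by
  conv_lhs => rw [← sliceLeft_counit_comul b, h]
  simp

theorem eq_of_comul_eq_one_tmul {b : A} (h : comul (R := ℂ) b = 1 ⊗ₜ[ℂ] b) :
    b = counit (R := ℂ) b • 1 := by
  conv_lhs => rw [← sliceRight_counit_comul b, h]
  simp

/-- A left invariant and a right invariant functional are proportional. -/
theorem apply_mul_apply_one_of_invariant {g h : A →ₗ[ℂ] ℂ}
    (hg : ∀ a, sliceLeft g (comul (R := ℂ) a) = g a • 1)
    (hh : ∀ a, sliceRight h (comul (R := ℂ) a) = h a • 1) (a : A) : g a * h 1 = h a * g 1 := by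
  have : h (sliceLeft g (comul (R := ℂ) a)) = g (sliceRight h (comul (R := ℂ) a)) := by
    induction comul (R := ℂ) a with
    | zero => simp
    | add X Y hX hY => simp only [map_add, hX, hY]
    | tmul x y => simp [mul_comm]
  simpa [hg, hh] using this

end Hopf

/-! ### The Haar functional, the integral and the antipode -/

section QuantumGroup

open Coalgebra

variable {A : Type*} [Ring A] [HopfAlgebra ℂ A] [StarRing A] [StarModule ℂ A]

instance [hA : FiniteQuantumGroup A] : FiniteDimensional ℂ A := hA.finiteDimensional

variable [hA : FiniteQuantumGroup A]

theorem isFrobenius_regularTrace : IsFrobenius (regularTrace A) :=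
  hA.exists_isFrobenius.choose_spec.isFrobenius_regularTrace

theorem regularTrace_one : regularTrace A 1 = Module.finrank ℂ A := by
  rw [regularTrace_apply, LinearMap.mulLeft_one]
  exact LinearMap.trace_id ℂ A

theorem tensorFunctional_regularTrace_comp_comul :
    tensorFunctional (regularTrace A) ∘ₗ comul (R := ℂ) =
      (Module.finrank ℂ A : ℂ) • regularTrace A := by
  ext a
  simp [tensorFunctional_regularTrace_comul]

theorem regularTrace_rightInvariant (a : A) :
    sliceRight (regularTrace A) (comul (R := ℂ) a) = regularTrace A a • 1 := by
  set ψ := regularTrace A with hψ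
  have hF : IsFrobenius ψ := isFrobenius_regularTrace
  set b := sliceRight ψ (comul (R := ℂ) a) with hb
  have hbb : sliceRight ψ (comul (R := ℂ) b) = (Module.finrank ℂ A : ℂ) • b := by
    rw [hb, sliceRight_comul_sliceRight_comul, tensorFunctional_regularTrace_comp_comul]
    simp [sliceRight, LinearMap.lTensor_smul, hψ]
  have hbs : sliceRight ψ (comul (R := ℂ) (star b)) = (Module.finrank ℂ A : ℂ) • star b := by
    rw [hA.comul_star, sliceRight_star hF, hbb]
    simp
  have h1 : ∀ (x y : A) (X : A ⊗[ℂ] A), tensorFunctional ψ ((x ⊗ₜ 1) * X * (y ⊗ₜ 1)) =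
      ψ (x * sliceRight ψ X * y) := fun x y X => (apply_mul_sliceRight ψ ψ x y X).symm
  -- The norm of Δ(b) - b ⊗ 1 expands into four terms, each equal to ± n ψ(b* b): absorption gives
  -- the first, `hbb` and `hbs` the cross terms, and ψ(1) = n the last. They cancel.
  have hX : comul (R := ℂ) b - b ⊗ₜ[ℂ] 1 = 0 := by
    refine hF.tensor.eq_zero_of_apply_eq_zero ?_
    have e1 := h1 1 b (comul (R := ℂ) (star b))
    have e2 := h1 (star b) 1 (comul (R := ℂ) b)
    have e3 := tensorFunctional_regularTrace_comul (star b * b)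
    rw [← hψ] at e3
    rw [star_sub, ← hA.comul_star, TensorProduct.star_tmul, star_one, sub_mul, mul_sub, mul_sub,
      ← Bialgebra.comul_mul, map_sub, map_sub, map_sub]
    rw [← Algebra.TensorProduct.one_def, one_mul, hbs, one_mul, smul_mul_assoc, map_smul] at e1
    rw [← Algebra.TensorProduct.one_def, mul_one, hbb, mul_one, mul_smul_comm, map_smul] at e2
    rw [e1, e2, e3, Algebra.TensorProduct.tmul_mul_tmul, tensorFunctional_tmul, one_mul, hψ,
      regularTrace_one]
    simp only [smul_eq_mul]
    ring
  have := eq_of_comul_eq_tmul_one (sub_eq_zero.1 hX)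
  rw [this, hb, counit_sliceRight_comul]

theorem regularTrace_leftInvariant (a : A) :
    sliceLeft (regularTrace A) (comul (R := ℂ) a) = regularTrace A a • 1 := by
  set ψ := regularTrace A with hψ
  have hF : IsFrobenius ψ := isFrobenius_regularTrace
  set b := sliceLeft ψ (comul (R := ℂ) a) with hb
  have hbb : sliceLeft ψ (comul (R := ℂ) b) = (Module.finrank ℂ A : ℂ) • b := by
    rw [hb, sliceLeft_comul_sliceLeft_comul, tensorFunctional_regularTrace_comp_comul]
    simp [sliceLeft, LinearMap.rTensor_smul, hψ]
  have hbs : sliceLeft ψ (comul (R := ℂ) (star b)) = (Module.finrank ℂ A : ℂ) • star b := by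
    rw [hA.comul_star, sliceLeft_star hF, hbb]
    simp
  have h1 : ∀ (x y : A) (X : A ⊗[ℂ] A), tensorFunctional ψ ((1 ⊗ₜ x) * X * (1 ⊗ₜ y)) =
      ψ (x * sliceLeft ψ X * y) := fun x y X => (apply_mul_sliceLeft ψ ψ x y X).symm
  have hX : comul (R := ℂ) b - 1 ⊗ₜ[ℂ] b = 0 := by
    refine hF.tensor.eq_zero_of_apply_eq_zero ?_
    have e1 := h1 1 b (comul (R := ℂ) (star b))
    have e2 := h1 (star b) 1 (comul (R := ℂ) b)
    have e3 := tensorFunctional_regularTrace_comul (star b * b)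
    rw [← hψ] at e3
    rw [star_sub, ← hA.comul_star, TensorProduct.star_tmul, star_one, sub_mul, mul_sub, mul_sub,
      ← Bialgebra.comul_mul, map_sub, map_sub, map_sub]
    rw [← Algebra.TensorProduct.one_def, one_mul, hbs, one_mul, smul_mul_assoc, map_smul] at e1
    rw [← Algebra.TensorProduct.one_def, mul_one, hbb, mul_one, mul_smul_comm, map_smul] at e2
    rw [e1, e2, e3, Algebra.TensorProduct.tmul_mul_tmul, tensorFunctional_tmul, one_mul, hψ,
      regularTrace_one]
    simp only [smul_eq_mul]
    ring
  have := eq_of_comul_eq_one_tmul (sub_eq_zero.1 hX)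
  rw [this, hb, counit_sliceLeft_comul]

theorem isHaar_regularTrace : IsHaar (regularTrace A) where
  toIsFrobenius := isFrobenius_regularTrace
  leftInvariant := regularTrace_leftInvariant
  symmetric := regularTrace_mul_comm
  special := mul_mulDagger_regularTrace hA.exists_isFrobenius.choose_spec

-- `haar` is a choice, so existence must come first; the symmetric and special conditions then pin
-- it down.
variable (A) in
theorem haar_eq_regularTrace : haar A = regularTrace A := by
  have h : IsHaar (haar A) := Classical.epsilon_spec (p := fun ψ : A →ₗ[ℂ] ℂ => IsHaar ψ)
    ⟨_, isHaar_regularTrace⟩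
  exact h.toIsFrobenius.eq_regularTrace h.symmetric h.special

variable (A) in
theorem isHaar_haar : IsHaar (haar A) := haar_eq_regularTrace A ▸ isHaar_regularTrace

theorem isHaar_iff {ψ : A →ₗ[ℂ] ℂ} : IsHaar ψ ↔ ψ = haar A := by
  refine ⟨fun h => ?_, fun h => h ▸ isHaar_haar A⟩
  rw [haar_eq_regularTrace]
  exact h.toIsFrobenius.eq_regularTrace h.symmetric h.special

variable (A) in
theorem haar_one : haar A 1 = Module.finrank ℂ A := by
  rw [haar_eq_regularTrace, regularTrace_one]

theorem haar_rightInvariant (a : A) :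
    sliceRight (haar A) (comul (R := ℂ) a) = haar A a • 1 := by
  rw [haar_eq_regularTrace, regularTrace_rightInvariant]

theorem haar_leftInvariant (a : A) :
    sliceLeft (haar A) (comul (R := ℂ) a) = haar A a • 1 :=
  (isHaar_haar A).leftInvariant a

theorem haar_mul_comm (a b : A) : haar A (a * b) = haar A (b * a) :=
  (isHaar_haar A).symmetric a b

theorem haar_star (a : A) : haar A (star a) = conj (haar A a) :=
  (isHaar_haar A).toIsFrobenius.map_star a

theorem haar_ext {x y : A} (h : ∀ z, haar A (z * x) = haar A (z * y)) : x = y := by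
  rw [← sub_eq_zero]
  refine (isHaar_haar A).nondegenerate _ fun b => ?_
  rw [haar_mul_comm, mul_sub, map_sub, h, sub_self]

omit [StarRing A] [StarModule ℂ A] hA in
theorem nontrivial_of_hopfAlgebra : Nontrivial A := by
  refine ⟨1, 0, fun h => ?_⟩
  simpa using congrArg (counit (R := ℂ)) h

theorem finrank_ne_zero : (Module.finrank ℂ A : ℂ) ≠ 0 := by
  have := nontrivial_of_hopfAlgebra (A := A)
  exact_mod_cast (Module.finrank_pos (R := ℂ) (M := A)).ne'

variable (A) in
theorem exists_integral : ∃ Λ : A, ∀ a, haar A (a * Λ) = counit (R := ℂ) a := by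
  obtain ⟨T, hT⟩ := exists_adjoint ((LinearMap.mul ℂ A).compr₂ (haar A)) (LinearMap.mul ℂ ℂ)
    (fun w hw => haar_ext fun z => by simpa using hw z) (counit (R := ℂ) (A := A))
  exact ⟨T 1, fun a => by simpa using (hT a 1).symm⟩

variable (A) in
/-- The two-sided integral `Λ` of `A`, the element which represents the counit. -/
noncomputable def integral : A := (exists_integral A).choose

theorem haar_mul_integral (a : A) : haar A (a * integral A) = counit (R := ℂ) a :=
  (exists_integral A).choose_spec a

theorem haar_integral_mul (a : A) : haar A (integral A * a) = counit (R := ℂ) a := by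
  rw [haar_mul_comm, haar_mul_integral]

variable (A) in
theorem haar_integral : haar A (integral A) = 1 := by
  simpa using haar_mul_integral (1 : A)

theorem mul_integral (a : A) : a * integral A = counit (R := ℂ) a • integral A :=
  haar_ext fun z => by
    rw [← mul_assoc, haar_mul_integral, mul_smul_comm, map_smul, haar_mul_integral,
      Bialgebra.counit_mul, smul_eq_mul, mul_comm]

theorem integral_mul (a : A) : integral A * a = counit (R := ℂ) a • integral A :=
  haar_ext fun z => by
    rw [haar_mul_comm, mul_assoc, haar_integral_mul, mul_smul_comm, map_smul, haar_mul_integral,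
      Bialgebra.counit_mul, smul_eq_mul]

variable (A) in
theorem star_integral : star (integral A) = integral A :=
  haar_ext fun z => by
    rw [haar_mul_integral, ← star_star z, ← star_mul, haar_star, haar_integral_mul,
      ← hA.counit_star]

local notation "S" => HopfAlgebra.antipode ℂ (A := A)

/-- Write 1 ⊗ a = ∑ (S(a₁) ⊗ 1) Δ(a₂); then Δ(a₂) Δ(Λ) = Δ(a₂ Λ) = ε(a₂) Δ(Λ). -/
theorem one_tmul_mul_comul_integral (a : A) :
    ((1 : A) ⊗ₜ[ℂ] a) * comul (R := ℂ) (integral A) =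
      (S a ⊗ₜ[ℂ] (1 : A)) * comul (R := ℂ) (integral A) := by
  rw [← sum_antipode_mul_comul a (ℛ ℂ a), Finset.sum_mul]
  simp only [mul_assoc, ← Bialgebra.comul_mul, mul_integral, map_smul]
  have h := sliceRight_counit_comul a
  rw [← (ℛ ℂ a).eq] at h
  simp only [map_sum, sliceRight_tmul] at h
  conv_rhs => rw [← h]
  simp [TensorProduct.sum_tmul, Finset.sum_mul, ← TensorProduct.smul_tmul']

theorem comul_integral_mul_tmul_one (a : A) :
    comul (R := ℂ) (integral A) * (a ⊗ₜ[ℂ] (1 : A)) =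
      comul (R := ℂ) (integral A) * ((1 : A) ⊗ₜ[ℂ] S a) := by
  rw [← sum_comul_mul_antipode a (ℛ ℂ a), Finset.mul_sum]
  simp only [← mul_assoc, ← Bialgebra.comul_mul, integral_mul, map_smul]
  conv_rhs => rw [← sum_counit_smul (R := ℂ) (ℛ ℂ a)]
  simp [TensorProduct.tmul_sum, Finset.mul_sum]

/-- Moving a to the other leg of Δ(Λ) as S(a) leaves the slice (id ⊗ ψ)Δ(Λ) = ψ(Λ) 1 = 1. -/
theorem antipode_eq_sliceRight (a : A) :
    S a = sliceRight (haar A) (((1 : A) ⊗ₜ[ℂ] a) * comul (R := ℂ) (integral A)) := by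
  have := sliceRight_mul (haar A) (S a) 1 (comul (R := ℂ) (integral A))
  rw [haar_rightInvariant, haar_integral, ← Algebra.TensorProduct.one_def, mul_one,
    ← one_tmul_mul_comul_integral] at this
  simpa using this.symm

theorem antipode_eq_sliceLeft (a : A) :
    S a = sliceLeft (haar A) (comul (R := ℂ) (integral A) * (a ⊗ₜ[ℂ] (1 : A))) := by
  have := sliceLeft_mul (haar A) 1 (S a) (comul (R := ℂ) (integral A))
  rw [haar_leftInvariant, haar_integral, ← Algebra.TensorProduct.one_def, one_mul,
    ← comul_integral_mul_tmul_one] at this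
  simpa using this.symm

theorem tensorFunctional_comul_integral_mul (a b : A) :
    tensorFunctional (haar A) (comul (R := ℂ) (integral A) * (a ⊗ₜ b)) = haar A (S a * b) := by
  rw [antipode_eq_sliceLeft]
  have := apply_mul_sliceLeft (haar A) (haar A) 1 b
    (comul (R := ℂ) (integral A) * (a ⊗ₜ[ℂ] (1 : A)))
  rw [one_mul, ← Algebra.TensorProduct.one_def, one_mul, mul_assoc,
    Algebra.TensorProduct.tmul_mul_tmul, mul_one, one_mul] at this
  exact this.symm

theorem tensorFunctional_mul_comm (X Y : A ⊗[ℂ] A) :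
    tensorFunctional (haar A) (X * Y) = tensorFunctional (haar A) (Y * X) := by
  induction X with
  | zero => simp
  | add X X' hX hX' => rw [add_mul, mul_add, map_add, map_add, hX, hX']
  | tmul x x' =>
    induction Y with
    | zero => simp
    | add Y Y' hY hY' => rw [add_mul, mul_add, map_add, map_add, hY, hY']
    | tmul y y' => simp [haar_mul_comm x, haar_mul_comm x']

/-- The left slice formula for S(a) gives (ψ ⊗ ψ)(Δ(Λ)(a ⊗ b)), the right one for S(b) gives (ψ ⊗
ψ)((a ⊗ b)Δ(Λ)), and ψ ⊗ ψ is tracial. -/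
theorem haar_antipode_mul (a b : A) : haar A (S a * b) = haar A (a * S b) := by
  rw [← tensorFunctional_comul_integral_mul, antipode_eq_sliceRight]
  have := apply_mul_sliceRight (haar A) (haar A) a 1
    (((1 : A) ⊗ₜ[ℂ] b) * comul (R := ℂ) (integral A))
  rw [mul_one, ← Algebra.TensorProduct.one_def, mul_one, ← mul_assoc,
    Algebra.TensorProduct.tmul_mul_tmul, mul_one, one_mul] at this
  rw [this, tensorFunctional_mul_comm]
  rfl

theorem haar_antipode (a : A) : haar A (S a) = haar A a := by
  simpa using haar_antipode_mul a 1

/-- The antipode of a finite quantum group is involutive. -/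
theorem antipode_antipode (a : A) : S (S a) = a :=
  haar_ext fun z => by
    rw [← haar_antipode_mul, ← HopfAlgebra.antipode_mul_antidistrib, haar_antipode, haar_mul_comm]

/-- Since Λ is self-adjoint, the involution only reverses the order of the factors in
`antipode_eq_sliceRight`, and traciality of ψ on the sliced leg restores it. -/
theorem antipode_star (a : A) : S (star a) = star (S a) := by
  rw [antipode_eq_sliceRight a, ← sliceRight_star (isHaar_haar A).toIsFrobenius, star_mul,
    ← hA.comul_star, star_integral, TensorProduct.star_tmul, star_one, antipode_eq_sliceRight]
  induction comul (R := ℂ) (integral A) with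
  | zero => simp
  | add X Y hX hY => rw [add_mul, mul_add, map_add, map_add, hX, hY]
  | tmul x y => simp [haar_mul_comm y]

end QuantumGroup

/-! ### Convolution and the unit of the dual -/

section Convolution

open Coalgebra

variable {A : Type*} [Ring A] [HopfAlgebra ℂ A] [StarRing A] [StarModule ℂ A]
  [hA : FiniteQuantumGroup A]

/-- Because Δ preserves the involution, its adjoint for the inner products is also its adjoint for
the bilinear forms of ψ. -/
theorem haar_mul_conv (z x y : A) : haar A (z * conv (haar A) x y) =
    tensorFunctional (haar A) (comul (R := ℂ) z * (x ⊗ₜ y)) := by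
  obtain ⟨T, hT⟩ := exists_adjoint ((LinearMap.mul ℂ A).compr₂ (haar A))
    ((LinearMap.mul ℂ (A ⊗[ℂ] A)).compr₂ (tensorFunctional (haar A)))
    (fun w hw => haar_ext fun z => by simpa using hw z) (comul (R := ℂ) (A := A))
  have h : comulDagger (haar A) = T := by
    refine adjointMap_eq (fun w w' hw => haar_ext fun z => ?_) fun v X => ?_
    · simpa [innerOne] using hw (star z)
    · rw [innerTwo_eq, innerOne, ← hA.comul_star]
      exact hT (star v) X
  rw [conv, h]
  exact (hT z (x ⊗ₜ y)).symm

theorem counitDagger_haar : counitDagger (haar A) = integral A := by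
  have h : adjointMap (innerOne (haar A)) (fun z w : ℂ => conj z * w)
      (counit (R := ℂ) (A := A)) = LinearMap.toSpanSingleton ℂ A (integral A) := by
    refine adjointMap_eq (fun w w' hw => haar_ext fun z => ?_) fun v c => ?_
    · simpa [innerOne] using hw (star z)
    · simp [innerOne, haar_mul_integral, hA.counit_star, mul_comm]
  rw [counitDagger, h]
  simp

theorem counit_conv (x y : A) :
    counit (R := ℂ) (conv (haar A) x y) = haar A (HopfAlgebra.antipode ℂ x * y) := by
  rw [← haar_integral_mul, haar_mul_conv, tensorFunctional_comul_integral_mul]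

/-- Applying S to the antipode axiom reverses the product, and S² = id removes the double antipode.
The dual needs this form because its comultiplication comes from the opposite product. -/
theorem sum_mul_antipode_swap (a : A) {ι : Type*} (𝓡 : Repr ℂ a ι) :
    ∑ i ∈ 𝓡.index, 𝓡.right i * HopfAlgebra.antipode ℂ (𝓡.left i) = counit (R := ℂ) a • 1 := by
  have h := congrArg (HopfAlgebra.antipode ℂ) (HopfAlgebra.sum_mul_antipode_eq_smul 𝓡)
  simpa [HopfAlgebra.antipode_mul_antidistrib, antipode_antipode] using h

theorem sum_antipode_mul_swap (a : A) {ι : Type*} (𝓡 : Repr ℂ a ι) :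
    ∑ i ∈ 𝓡.index, HopfAlgebra.antipode ℂ (𝓡.right i) * 𝓡.left i = counit (R := ℂ) a • 1 := by
  have h := congrArg (HopfAlgebra.antipode ℂ) (HopfAlgebra.sum_antipode_mul_eq_smul 𝓡)
  simpa [HopfAlgebra.antipode_mul_antidistrib, antipode_antipode] using h

end Convolution

/-! ### Construction of the dual finite quantum group -/

section Dual

open Coalgebra

/-- The dual of the Hopf algebra `A`, with the convolution product of functionals. -/
def DualAlgebra (A : Type*) [Ring A] [HopfAlgebra ℂ A] : Type _ := WithConv (A →ₗ[ℂ] ℂ)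

namespace DualAlgebra

noncomputable section

section Algebra

variable {A : Type*} [Ring A] [HopfAlgebra ℂ A]

instance : Ring (DualAlgebra A) := inferInstanceAs (Ring (WithConv (A →ₗ[ℂ] ℂ)))

instance : Algebra ℂ (DualAlgebra A) := inferInstanceAs (Algebra ℂ (WithConv (A →ₗ[ℂ] ℂ)))

variable (A) in
/-- The elements of the dual as functionals. -/
def toDual : DualAlgebra A ≃ₗ[ℂ] Module.Dual ℂ A := WithConv.linearEquiv ℂ (A →ₗ[ℂ] ℂ)

@[ext]
theorem ext {f g : DualAlgebra A} (h : ∀ x, toDual A f x = toDual A g x) : f = g :=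
  (toDual A).injective (LinearMap.ext h)

theorem toDual_mul (f g : DualAlgebra A) (x : A) : toDual A (f * g) x =
    LinearMap.mul' ℂ ℂ (TensorProduct.map (toDual A f) (toDual A g) (comul (R := ℂ) x)) := rfl

theorem toDual_mul_repr (f g : DualAlgebra A) {x : A} {ι : Type*} (𝓡 : Repr ℂ x ι) :
    toDual A (f * g) x = ∑ i ∈ 𝓡.index, toDual A f (𝓡.left i) * toDual A g (𝓡.right i) := by
  simp [toDual_mul, ← 𝓡.eq]

theorem toDual_one (x : A) : toDual A 1 x = counit (R := ℂ) x := rfl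

theorem toDual_algebraMap (c : ℂ) (x : A) :
    toDual A (algebraMap ℂ (DualAlgebra A) c) x = c * counit (R := ℂ) x := rfl

variable [FiniteDimensional ℂ A]

instance : FiniteDimensional ℂ (DualAlgebra A) :=
  Module.Finite.equiv (toDual A).symm

variable (A) in
/-- The pairing of tensors in the dual with tensors. -/
def pairTwo : DualAlgebra A ⊗[ℂ] DualAlgebra A ≃ₗ[ℂ] Module.Dual ℂ (A ⊗[ℂ] A) :=
  TensorProduct.congr (toDual A) (toDual A) ≪≫ₗ TensorProduct.dualDistribEquiv ℂ A A

@[simp]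
theorem pairTwo_tmul (f g : DualAlgebra A) (x y : A) :
    pairTwo A (f ⊗ₜ g) (x ⊗ₜ y) = toDual A f x * toDual A g y := by
  simp [pairTwo]

theorem pairTwo_ext {F G : DualAlgebra A ⊗[ℂ] DualAlgebra A}
    (h : ∀ x y, pairTwo A F (x ⊗ₜ y) = pairTwo A G (x ⊗ₜ y)) : F = G :=
  (pairTwo A).injective (TensorProduct.ext' h)

variable (A) in
/-- The pairing of triple tensors in the dual with triple tensors. -/
def pairThree : DualAlgebra A ⊗[ℂ] (DualAlgebra A ⊗[ℂ] DualAlgebra A) ≃ₗ[ℂ]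
    Module.Dual ℂ (A ⊗[ℂ] (A ⊗[ℂ] A)) :=
  TensorProduct.congr (toDual A) (pairTwo A) ≪≫ₗ TensorProduct.dualDistribEquiv ℂ A (A ⊗[ℂ] A)

@[simp]
theorem pairThree_tmul (f : DualAlgebra A) (G : DualAlgebra A ⊗[ℂ] DualAlgebra A) (x : A)
    (Y : A ⊗[ℂ] A) : pairThree A (f ⊗ₜ G) (x ⊗ₜ Y) = toDual A f x * pairTwo A G Y := by
  simp [pairThree]

theorem pairThree_ext {F G : DualAlgebra A ⊗[ℂ] (DualAlgebra A ⊗[ℂ] DualAlgebra A)}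
    (h : ∀ x y z, pairThree A F (x ⊗ₜ (y ⊗ₜ z)) = pairThree A G (x ⊗ₜ (y ⊗ₜ z))) : F = G :=
  (pairThree A).injective (by ext x y z; exact h x y z)

theorem pairTwo_mul (F G : DualAlgebra A ⊗[ℂ] DualAlgebra A) {x y : A} {ι κ : Type*}
    (𝓡 : Repr ℂ x ι) (𝓢 : Repr ℂ y κ) :
    pairTwo A (F * G) (x ⊗ₜ y) = ∑ i ∈ 𝓡.index, ∑ j ∈ 𝓢.index,
      pairTwo A F (𝓡.left i ⊗ₜ 𝓢.left j) * pairTwo A G (𝓡.right i ⊗ₜ 𝓢.right j) := by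
  induction F with
  | zero => simp
  | add F F' hF hF' =>
    simp only [add_mul, map_add, LinearMap.add_apply, hF, hF', Finset.sum_add_distrib]
  | tmul f f' =>
    induction G with
    | zero => simp
    | add G G' hG hG' =>
      simp only [mul_add, map_add, LinearMap.add_apply, hG, hG', Finset.sum_add_distrib]
    | tmul g g' =>
      rw [Algebra.TensorProduct.tmul_mul_tmul, pairTwo_tmul, toDual_mul_repr _ _ 𝓡,
        toDual_mul_repr _ _ 𝓢, Finset.sum_mul_sum]
      refine Finset.sum_congr rfl fun i _ => Finset.sum_congr rfl fun j _ => ?_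
      rw [pairTwo_tmul, pairTwo_tmul]
      ring

theorem toDual_mul' (F : DualAlgebra A ⊗[ℂ] DualAlgebra A) (x : A) :
    toDual A (LinearMap.mul' ℂ (DualAlgebra A) F) x = pairTwo A F (comul (R := ℂ) x) := by
  induction F with
  | zero => simp
  | add F F' hF hF' => simp only [map_add, LinearMap.add_apply, hF, hF']
  | tmul f g =>
    rw [LinearMap.mul'_apply, toDual_mul]
    induction comul (R := ℂ) x with
    | zero => simp
    | add X Y hX hY => rw [map_add, map_add, map_add, hX, hY]
    | tmul x y => simp

/-- The comultiplication of the dual is the transpose of the opposite multiplication. -/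
instance : CoalgebraStruct ℂ (DualAlgebra A) where
  comul := (pairTwo A).symm.toLinearMap ∘ₗ
    (LinearMap.mul' ℂ A ∘ₗ (TensorProduct.comm ℂ A A).toLinearMap).dualMap ∘ₗ
      (toDual A).toLinearMap
  counit := LinearMap.applyₗ 1 ∘ₗ (toDual A).toLinearMap

@[simp]
theorem pairTwo_comul (f : DualAlgebra A) (x y : A) :
    pairTwo A (comul (R := ℂ) f) (x ⊗ₜ y) = toDual A f (y * x) := by
  simp [comul]

@[simp]
theorem counit_apply (f : DualAlgebra A) : counit (R := ℂ) f = toDual A f 1 := rfl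

instance : Coalgebra ℂ (DualAlgebra A) where
  coassoc := by
    have h1 : ∀ (F : DualAlgebra A ⊗[ℂ] DualAlgebra A) (x y z : A),
        pairThree A (LinearMap.lTensor _ comul F) (x ⊗ₜ (y ⊗ₜ z)) =
          pairTwo A F (x ⊗ₜ (z * y)) := by
      intro F x y z
      induction F with
      | zero => simp
      | add F G hF hG => simp only [map_add, LinearMap.add_apply, hF, hG]
      | tmul f g => simp
    have h2 : ∀ (F : DualAlgebra A ⊗[ℂ] DualAlgebra A) (h : DualAlgebra A) (x y z : A),
        pairThree A (TensorProduct.assoc ℂ _ _ _ (F ⊗ₜ h)) (x ⊗ₜ (y ⊗ₜ z)) =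
          pairTwo A F (x ⊗ₜ y) * toDual A h z := by
      intro F h x y z
      induction F with
      | zero => simp
      | add F G hF hG =>
        simp only [TensorProduct.add_tmul, map_add, LinearMap.add_apply, hF, hG, add_mul]
      | tmul f g => simp [mul_assoc]
    have h3 : ∀ (F : DualAlgebra A ⊗[ℂ] DualAlgebra A) (x y z : A),
        pairThree A (TensorProduct.assoc ℂ _ _ _ (LinearMap.rTensor _ comul F))
          (x ⊗ₜ (y ⊗ₜ z)) = pairTwo A F ((y * x) ⊗ₜ z) := by
      intro F x y z
      induction F with
      | zero => simp
      | add F G hF hG => simp only [map_add, LinearMap.add_apply, hF, hG]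
      | tmul f g => simp [h2]
    refine LinearMap.ext fun f => pairThree_ext fun x y z => ?_
    simp only [LinearMap.comp_apply, LinearEquiv.coe_coe, h1, h3, pairTwo_comul, mul_assoc]
  rTensor_counit_comp_comul := by
    have h1 : ∀ (F : DualAlgebra A ⊗[ℂ] DualAlgebra A) (x : A),
        toDual A (TensorProduct.lid ℂ _ (LinearMap.rTensor _ counit F)) x =
          pairTwo A F (1 ⊗ₜ x) := by
      intro F x
      induction F with
      | zero => simp
      | add F G hF hG => simp only [map_add, LinearMap.add_apply, hF, hG]
      | tmul f g => simp
    refine LinearMap.ext fun f => (TensorProduct.lid ℂ _).injective (ext fun x => ?_)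
    rw [LinearMap.comp_apply, h1]
    simp
  lTensor_counit_comp_comul := by
    have h1 : ∀ (F : DualAlgebra A ⊗[ℂ] DualAlgebra A) (x : A),
        toDual A (TensorProduct.rid ℂ _ (LinearMap.lTensor _ counit F)) x =
          pairTwo A F (x ⊗ₜ 1) := by
      intro F x
      induction F with
      | zero => simp
      | add F G hF hG => simp only [map_add, LinearMap.add_apply, hF, hG]
      | tmul f g => simp [mul_comm]
    refine LinearMap.ext fun f => (TensorProduct.rid ℂ _).injective (ext fun x => ?_)
    rw [LinearMap.comp_apply, h1]
    simp

instance : Bialgebra ℂ (DualAlgebra A) :=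
  Bialgebra.mk' ℂ (DualAlgebra A)
    (by rw [counit_apply, toDual_one, Bialgebra.counit_one])
    (fun {f g} => by simp [toDual_mul, Algebra.TensorProduct.one_def])
    (pairTwo_ext fun x y => by
      simp [Algebra.TensorProduct.one_def, toDual_one, mul_comm])
    (fun {f g} => pairTwo_ext fun x y => by
      rw [pairTwo_comul, pairTwo_mul _ _ (ℛ ℂ x) (ℛ ℂ y),
        toDual_mul_repr f g ((ℛ ℂ y).mul (ℛ ℂ x))]
      simp [Finset.sum_product_right])

end Algebra

section Star

variable {A : Type*} [Ring A] [HopfAlgebra ℂ A] [StarRing A] [StarModule ℂ A]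
  [hA : FiniteQuantumGroup A]

instance : HopfAlgebraStruct ℂ (DualAlgebra A) where
  antipode := (toDual A).symm.toLinearMap ∘ₗ (HopfAlgebra.antipode ℂ (A := A)).dualMap ∘ₗ
    (toDual A).toLinearMap

@[simp]
theorem toDual_antipode (f : DualAlgebra A) (x : A) :
    toDual A (HopfAlgebra.antipode ℂ f) x = toDual A f (HopfAlgebra.antipode ℂ x) := by
  simp [HopfAlgebra.antipode]

instance : HopfAlgebra ℂ (DualAlgebra A) where
  mul_antipode_rTensor_comul := by
    have h1 : ∀ (F : DualAlgebra A ⊗[ℂ] DualAlgebra A) (x y : A),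
        pairTwo A (LinearMap.rTensor _ (HopfAlgebra.antipode ℂ) F) (x ⊗ₜ y) =
          pairTwo A F (HopfAlgebra.antipode ℂ x ⊗ₜ y) := by
      intro F x y
      induction F with
      | zero => simp
      | add F G hF hG => simp only [map_add, LinearMap.add_apply, hF, hG]
      | tmul f g => simp
    refine LinearMap.ext fun f => ext fun x => ?_
    rw [LinearMap.comp_apply, toDual_mul', LinearMap.comp_apply, ← (ℛ ℂ x).eq]
    simp only [map_sum, h1, pairTwo_comul]
    rw [← map_sum, sum_mul_antipode_swap]
    simp [toDual_algebraMap, mul_comm]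
  mul_antipode_lTensor_comul := by
    have h1 : ∀ (F : DualAlgebra A ⊗[ℂ] DualAlgebra A) (x y : A),
        pairTwo A (LinearMap.lTensor _ (HopfAlgebra.antipode ℂ) F) (x ⊗ₜ y) =
          pairTwo A F (x ⊗ₜ HopfAlgebra.antipode ℂ y) := by
      intro F x y
      induction F with
      | zero => simp
      | add F G hF hG => simp only [map_add, LinearMap.add_apply, hF, hG]
      | tmul f g => simp
    refine LinearMap.ext fun f => ext fun x => ?_
    rw [LinearMap.comp_apply, toDual_mul', LinearMap.comp_apply, ← (ℛ ℂ x).eq]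
    simp only [map_sum, h1, pairTwo_comul]
    rw [← map_sum, sum_antipode_mul_swap]
    simp [toDual_algebraMap, mul_comm]

/-- The involution `f⋆ x = conj (f (S x*))`. -/
instance : Star (DualAlgebra A) where
  star f := (toDual A).symm
    { toFun := fun x => conj (toDual A f (HopfAlgebra.antipode ℂ (star x)))
      map_add' := fun x y => by simp
      map_smul' := fun c x => by simp }

omit hA in
theorem toDual_star (f : DualAlgebra A) (x : A) :
    toDual A (star f) x = conj (toDual A f (HopfAlgebra.antipode ℂ (star x))) := by
  simp [star]

instance : StarRing (DualAlgebra A) where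
  star_involutive f := ext fun x => by
    simp [toDual_star, ← antipode_star, antipode_antipode]
  -- Δ preserves the involution, so the reversal of order comes from the antipode of the dual, which
  -- is anti-multiplicative.
  star_mul f g := ext fun x => by
    rw [toDual_star, ← toDual_antipode, HopfAlgebra.antipode_mul_antidistrib, toDual_mul,
      toDual_mul, hA.comul_star]
    induction comul (R := ℂ) x with
    | zero => simp
    | add X Y hX hY => rw [star_add, map_add, map_add, map_add, hX, hY, map_add, map_add]
    | tmul x y => simp [toDual_star]
  star_add f g := ext fun x => by simp [toDual_star]

instance : StarModule ℂ (DualAlgebra A) where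
  star_smul c f := ext fun x => by simp [toDual_star]

variable (A) in
/-- The Fourier transform `x ↦ ψ (· x)`. -/
def fourier : A ≃ₗ[ℂ] DualAlgebra A :=
  LinearEquiv.ofInjectiveOfFinrankEq
      (((LinearMap.mul ℂ A).compr₂ (haar A)).flip : A →ₗ[ℂ] Module.Dual ℂ A)
      (fun _ _ hxy => haar_ext fun z => LinearMap.congr_fun hxy z)
      Subspace.dual_finrank_eq.symm ≪≫ₗ (toDual A).symm

@[simp]
theorem toDual_fourier (x z : A) : toDual A (fourier A x) z = haar A (z * x) := rfl

theorem fourier_conv (x y : A) : fourier A (conv (haar A) x y) = fourier A x * fourier A y := by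
  refine ext fun z => ?_
  rw [toDual_fourier, haar_mul_conv, toDual_mul]
  induction comul (R := ℂ) z with
  | zero => simp
  | add X Y hX hY => simp only [add_mul, map_add, hX, hY]
  | tmul z w => simp

theorem star_fourier (x : A) : star (fourier A x) = fourier A (convStar x) := by
  refine ext fun z => ?_
  rw [toDual_star, toDual_fourier, toDual_fourier, ← haar_star, star_mul, convStar,
    ← haar_antipode_mul, ← antipode_star, star_star, haar_mul_comm]

theorem pairTwo_star (F : DualAlgebra A ⊗[ℂ] DualAlgebra A) (x y : A) :
    pairTwo A (star F) (x ⊗ₜ y) = conj (pairTwo A F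
      (HopfAlgebra.antipode ℂ (star x) ⊗ₜ HopfAlgebra.antipode ℂ (star y))) := by
  induction F with
  | zero => simp
  | add F G hF hG => simp only [star_add, map_add, LinearMap.add_apply, hF, hG]
  | tmul f g => simp [toDual_star]

instance : FiniteQuantumGroup (DualAlgebra A) where
  finiteDimensional := inferInstance
  comul_star f := pairTwo_ext fun x y => by
    rw [pairTwo_star, pairTwo_comul, pairTwo_comul, toDual_star, star_mul,
      HopfAlgebra.antipode_mul_antidistrib]
  counit_star f := by simp [toDual_star]
  exists_isFrobenius := by
    -- The faithful positive functional is evaluation at Λ: on transforms it is ψ(S(x) y), hence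
    -- ψ(x* x) on a square.
    have key : ∀ x y : A, toDual A (fourier A x * fourier A y) (integral A) =
        haar A (HopfAlgebra.antipode ℂ x * y) := fun x y => by
      rw [← fourier_conv, toDual_fourier, haar_integral_mul, counit_conv]
    refine ⟨LinearMap.applyₗ (integral A) ∘ₗ (toDual A).toLinearMap, fun f => ?_, fun f hf => ?_⟩
    · obtain ⟨x, rfl⟩ := (fourier A).surjective f
      change 0 ≤ toDual A (star (fourier A x) * fourier A x) (integral A)
      rw [star_fourier, key, convStar, antipode_antipode]
      exact (isHaar_haar A).nonneg x
    · obtain ⟨x, rfl⟩ := (fourier A).surjective f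
      have h0 : HopfAlgebra.antipode ℂ x = 0 := (isHaar_haar A).nondegenerate _ fun y => by
        rw [← key]
        exact hf (fourier A y)
      rw [← antipode_antipode x, h0, map_zero, map_zero]

theorem isFourierTransform_fourier : IsFourierTransform (fourier A) where
  map_mul := fourier_conv
  map_one := ext fun z => by
    rw [toDual_fourier, counitDagger_haar, haar_mul_integral, toDual_one]
  -- Both sides pair with z ⊗ w to ψ(w z x), via z = ∑ ψ(z bᵢ) bᵢ*. This is why the dual
  -- comultiplication uses the opposite product.
  map_comul x := pairTwo_ext fun z w => by
    obtain ⟨b, hb⟩ := (isHaar_haar A).toIsFrobenius.exists_orthonormal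
    rw [pairTwo_comul, toDual_fourier, mulDagger_apply (isHaar_haar A).toIsFrobenius hb]
    conv_lhs => rw [← hb.sum_apply_smul_star (isHaar_haar A).toIsFrobenius z]
    simp [Finset.sum_mul, Finset.mul_sum, mul_assoc]
  map_counit x := by simp
  map_antipode x := ext fun z => by
    rw [toDual_antipode, toDual_fourier, toDual_fourier, haar_antipode_mul]
  map_star := star_fourier

end Star

end

end DualAlgebra

end Dual

/-! ### Forms and adjoints on tensor powers -/

section TensorPower

variable {A : Type*} [Ring A] [Algebra ℂ A]

theorem tensorPower_induction {k : ℕ} {p : (⨂[ℂ]^k A) → Prop} (x : ⨂[ℂ]^k A)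
    (tprod : ∀ (c : ℂ) (f : Fin k → A), p (c • PiTensorProduct.tprod ℂ f))
    (add : ∀ x y, p x → p y → p (x + y)) : p x :=
  PiTensorProduct.induction_on x tprod add

@[simp]
theorem powFunctional_tprod (ψ : A →ₗ[ℂ] ℂ) {k : ℕ} (f : Fin k → A) :
    powFunctional ψ k (PiTensorProduct.tprod ℂ f) = ∏ i, ψ (f i) := by
  simp [powFunctional]

variable (A) in
/-- The reversal of the tensor factors. -/
noncomputable def powRev (k : ℕ) : (⨂[ℂ]^k A) ≃ₗ[ℂ] ⨂[ℂ]^k A :=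
  PiTensorProduct.reindex ℂ (fun _ => A) Fin.revPerm

@[simp]
theorem powRev_tprod {k : ℕ} (f : Fin k → A) :
    powRev A k (PiTensorProduct.tprod ℂ f) = PiTensorProduct.tprod ℂ fun i => f i.rev := by
  unfold powRev
  erw [PiTensorProduct.reindex_tprod]
  rfl

theorem powRev_powRev {k : ℕ} (x : ⨂[ℂ]^k A) : powRev A k (powRev A k x) = x := by
  induction x using tensorPower_induction with
  | tprod c f => simp
  | add x y hx hy => simp [hx, hy]

/-- The bilinear form `(x, y) ↦ (ψ ⊗ ⋯ ⊗ ψ) (x y)`. -/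
noncomputable def powForm (ψ : A →ₗ[ℂ] ℂ) (k : ℕ) : (⨂[ℂ]^k A) →ₗ[ℂ] (⨂[ℂ]^k A) →ₗ[ℂ] ℂ :=
  (LinearMap.mul ℂ (⨂[ℂ]^k A)).compr₂ (powFunctional ψ k)

theorem powForm_apply (ψ : A →ₗ[ℂ] ℂ) (k : ℕ) (x y : ⨂[ℂ]^k A) :
    powForm ψ k x y = powFunctional ψ k (x * y) := rfl

@[simp]
theorem powForm_tprod (ψ : A →ₗ[ℂ] ℂ) {k : ℕ} (f g : Fin k → A) :
    powForm ψ k (PiTensorProduct.tprod ℂ f) (PiTensorProduct.tprod ℂ g) = ∏ i, ψ (f i * g i) := by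
  rw [powForm_apply, PiTensorProduct.tprod_mul_tprod, powFunctional_tprod]
  rfl

theorem powBilin_eq_powForm (ψ : A →ₗ[ℂ] ℂ) (k : ℕ) (x y : ⨂[ℂ]^k A) :
    powBilin ψ k x y = powForm ψ k (powRev A k x) y := rfl

/-- The tensor power of a linear equivalence. -/
noncomputable def powMap {B : Type*} [Ring B] [Algebra ℂ B] (Φ : A ≃ₗ[ℂ] B) (k : ℕ) :
    (⨂[ℂ]^k A) →ₗ[ℂ] ⨂[ℂ]^k B :=
  PiTensorProduct.map fun _ => Φ.toLinearMap

section PowMap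

variable {B : Type*} [Ring B] [Algebra ℂ B] (Φ : A ≃ₗ[ℂ] B)

@[simp]
theorem powMap_tprod {k : ℕ} (f : Fin k → A) :
    powMap Φ k (PiTensorProduct.tprod ℂ f) = PiTensorProduct.tprod ℂ fun i => Φ (f i) := by
  simp [powMap]

theorem powMap_symm_powMap {k : ℕ} (x : ⨂[ℂ]^k A) : powMap Φ.symm k (powMap Φ k x) = x := by
  induction x using tensorPower_induction with
  | tprod c f => simp
  | add x y hx hy => simp only [map_add, hx, hy]

theorem powMap_surjective (k : ℕ) : Function.Surjective (powMap Φ k) :=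
  fun y => ⟨powMap Φ.symm k y, powMap_symm_powMap Φ.symm y⟩

theorem powRev_powMap {k : ℕ} (x : ⨂[ℂ]^k A) :
    powRev B k (powMap Φ k x) = powMap Φ k (powRev A k x) := by
  induction x using tensorPower_induction with
  | tprod c f => simp
  | add x y hx hy => simp only [map_add, hx, hy]

theorem hat_powMap {k l : ℕ} (T : (⨂[ℂ]^k A) →ₗ[ℂ] ⨂[ℂ]^l A) (x : ⨂[ℂ]^k A) :
    hat Φ T (powMap Φ k x) = powMap Φ l (T x) := by
  change powMap Φ l (T (powMap Φ.symm k (powMap Φ k x))) = _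
  rw [powMap_symm_powMap]

end PowMap

variable [StarRing A] [StarModule ℂ A]

theorem powInner_eq_powForm (ψ : A →ₗ[ℂ] ℂ) (k : ℕ) (x y : ⨂[ℂ]^k A) :
    powInner ψ k x y = powForm ψ k (powStar k x) y := rfl

theorem powStar_smul {k : ℕ} (c : ℂ) (x : ⨂[ℂ]^k A) :
    powStar k (c • x) = conj c • powStar k x := by
  induction x using tensorPower_induction with
  | tprod d f =>
    have h : ∀ (e : ℂ) (f : Fin k → A), powStar k (e • PiTensorProduct.tprod ℂ f) =
        conj e • PiTensorProduct.tprod ℂ (star f) := fun e f => by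
      rw [← PiTensorProduct.tprodCoeff_eq_smul_tprod]
      rfl
    rw [smul_smul, h, h, map_mul, smul_smul]
  | add x y hx hy => rw [smul_add, map_add, map_add, hx, hy, smul_add]

@[simp]
theorem powStar_powStar {k : ℕ} (x : ⨂[ℂ]^k A) : powStar k (powStar k x) = x := by
  induction x using tensorPower_induction with
  | tprod c f => simp [powStar_smul, powStar_tprod]
  | add x y hx hy => rw [map_add, map_add, hx, hy]

instance [FiniteDimensional ℂ A] (k : ℕ) : FiniteDimensional ℂ (⨂[ℂ]^k A) :=
  Module.Finite.of_basis (Basis.piTensorProduct fun _ => Module.finBasis ℂ A)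

/-- Pairing with the tensors of the bᵢ* reads off the coordinates in the tensor power of an
orthonormal basis. -/
theorem IsFrobenius.powForm_nondegenerate [FiniteDimensional ℂ A] {ψ : A →ₗ[ℂ] ℂ}
    (h : IsFrobenius ψ) {k : ℕ} (y : ⨂[ℂ]^k A) (hy : ∀ x, powForm ψ k x y = 0) : y = 0 := by
  obtain ⟨b, hb⟩ := h.exists_orthonormal
  let B := Basis.piTensorProduct (ι := Fin k) fun _ => b
  have key : ∀ (I : Fin k → Fin (Module.finrank ℂ A)) (y : ⨂[ℂ]^k A),
      powForm ψ k (PiTensorProduct.tprod ℂ fun i => star (b (I i))) y = B.repr y I := by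
    intro I y
    induction y using tensorPower_induction with
    | tprod c f => simp [B, hb.repr_apply]
    | add x y hx hy => simp [hx, hy]
  refine B.ext_elem fun I => ?_
  rw [← key, hy]
  simp

theorem IsFrobenius.exists_transpose [FiniteDimensional ℂ A] {ψ : A →ₗ[ℂ] ℂ}
    (h : IsFrobenius ψ) {k l : ℕ} (T : (⨂[ℂ]^k A) →ₗ[ℂ] ⨂[ℂ]^l A) :
    ∃ T' : (⨂[ℂ]^l A) →ₗ[ℂ] ⨂[ℂ]^k A, ∀ v w,
      powBilin ψ l (T v) w = powBilin ψ k v (T' w) := by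
  refine exists_adjoint (powForm ψ k ∘ₗ (powRev A k).toLinearMap)
    (powForm ψ l ∘ₗ (powRev A l).toLinearMap) (fun w hw => ?_) T
  refine h.powForm_nondegenerate w fun x => ?_
  simpa [powRev_powRev] using hw (powRev A k x)

theorem IsFrobenius.exists_dagger [FiniteDimensional ℂ A] {ψ : A →ₗ[ℂ] ℂ}
    (h : IsFrobenius ψ) {k l : ℕ} (T : (⨂[ℂ]^k A) →ₗ[ℂ] ⨂[ℂ]^l A) :
    ∃ T' : (⨂[ℂ]^l A) →ₗ[ℂ] ⨂[ℂ]^k A, ∀ v w,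
      powInner ψ l (T v) w = powInner ψ k v (T' w) := by
  -- Conjugating T by the involutions gives a linear map whose bilinear adjoint is the adjoint of T
  -- for the inner products.
  let T₁ : (⨂[ℂ]^k A) →ₗ[ℂ] ⨂[ℂ]^l A :=
    { toFun := fun x => powStar l (T (powStar k x))
      map_add' := fun x y => by simp only [map_add]
      map_smul' := fun c x => by simp [powStar_smul] }
  obtain ⟨T', hT'⟩ := exists_adjoint (powForm ψ k) (powForm ψ l) h.powForm_nondegenerate T₁
  refine ⟨T', fun v w => ?_⟩
  rw [powInner_eq_powForm, powInner_eq_powForm, ← hT']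
  simp [T₁]

theorem IsFrobenius.powBilin_transpose [FiniteDimensional ℂ A] {ψ : A →ₗ[ℂ] ℂ}
    (h : IsFrobenius ψ) {k l : ℕ} (T : (⨂[ℂ]^k A) →ₗ[ℂ] ⨂[ℂ]^l A) (v : ⨂[ℂ]^k A)
    (w : ⨂[ℂ]^l A) : powBilin ψ l (T v) w = powBilin ψ k v (transpose ψ T w) :=
  Classical.epsilon_spec (p := fun T' : (⨂[ℂ]^l A) →ₗ[ℂ] ⨂[ℂ]^k A => ∀ v w,
    powBilin ψ l (T v) w = powBilin ψ k v (T' w)) (h.exists_transpose T) v w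

theorem IsFrobenius.powInner_dagger [FiniteDimensional ℂ A] {ψ : A →ₗ[ℂ] ℂ}
    (h : IsFrobenius ψ) {k l : ℕ} (T : (⨂[ℂ]^k A) →ₗ[ℂ] ⨂[ℂ]^l A) (v : ⨂[ℂ]^k A)
    (w : ⨂[ℂ]^l A) : powInner ψ l (T v) w = powInner ψ k v (dagger ψ T w) :=
  Classical.epsilon_spec (p := fun T' : (⨂[ℂ]^l A) →ₗ[ℂ] ⨂[ℂ]^k A => ∀ v w,
    powInner ψ l (T v) w = powInner ψ k v (T' w)) (h.exists_dagger T) v w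

end TensorPower

/-! ### The Fourier transform onto an arbitrary dual -/

section Fourier

open Coalgebra

variable {A : Type*} [Ring A] [HopfAlgebra ℂ A] [StarRing A] [StarModule ℂ A]
  [hA : FiniteQuantumGroup A]
  {B : Type*} [Ring B] [HopfAlgebra ℂ B] [StarRing B] [StarModule ℂ B]
  {Φ : A ≃ₗ[ℂ] B}

omit [StarRing A] [StarModule ℂ A] hA in
@[simp]
theorem powAntipode_tprod {k : ℕ} (f : Fin k → A) :
    powAntipode A k (PiTensorProduct.tprod ℂ f) =
      PiTensorProduct.tprod ℂ fun i => HopfAlgebra.antipode ℂ (f i) := by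
  simp [powAntipode]

theorem powAntipode_powAntipode {k : ℕ} (x : ⨂[ℂ]^k A) :
    powAntipode A k (powAntipode A k x) = x := by
  induction x using tensorPower_induction with
  | add x y hx hy => simp only [map_add, hx, hy]
  | tprod c f => simp [antipode_antipode]

theorem powForm_powAntipode {k : ℕ} (x y : ⨂[ℂ]^k A) :
    powForm (haar A) k (powAntipode A k x) y = powForm (haar A) k x (powAntipode A k y) := by
  induction x using tensorPower_induction with
  | add x x' hx hx' => simp only [map_add, LinearMap.add_apply, hx, hx']
  | tprod r f =>
    induction y using tensorPower_induction with
    | add y y' hy hy' => simp only [map_add, hy, hy']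
    | tprod s g => simp [haar_antipode_mul]

-- Left multiplication by Λ is the rank-one map x ↦ ε(x) Λ, with trace ε(Λ); but its trace is also
-- ψ(Λ) = 1.
variable (A) in
theorem counit_integral : counit (R := ℂ) (integral A) = 1 := by
  have h : LinearMap.mulLeft ℂ (integral A) =
      (counit (R := ℂ) (A := A)).smulRight (integral A) := by
    ext x
    simp [integral_mul]
  rw [← haar_integral A, haar_eq_regularTrace, regularTrace_apply, h,
    LinearMap.trace_smulRight]

theorem innerTwo_mulDagger (z : A) (X : A ⊗[ℂ] A) :
    innerTwo (haar A) (mulDagger (haar A) z) X =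
      innerOne (haar A) z (LinearMap.mul' ℂ A X) := by
  obtain ⟨b, hb⟩ := (isHaar_haar A).toIsFrobenius.exists_orthonormal
  rw [mulDagger_apply (isHaar_haar A).toIsFrobenius hb, innerTwo_eq, innerOne]
  induction X with
  | zero => simp
  | add X Y hX hY => simp only [mul_add, map_add, hX, hY]
  | tmul p q =>
    conv_rhs => rw [← hb.sum_apply_smul p]
    simp [star_sum, Finset.sum_mul, Finset.mul_sum, mul_assoc]

/-- `ω = ε ∘ Φ⁻¹`. -/
noncomputable def counitFunctional (Φ : A ≃ₗ[ℂ] B) : B →ₗ[ℂ] ℂ :=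
  Coalgebra.counit (R := ℂ) (A := A) ∘ₗ Φ.symm.toLinearMap

namespace IsFourierTransform

omit [StarRing A] [StarModule ℂ A] hA [StarRing B] [StarModule ℂ B] in
theorem counitFunctional_apply (Φ : A ≃ₗ[ℂ] B) (x : A) :
    counitFunctional Φ (Φ x) = counit (R := ℂ) x := by
  simp [counitFunctional]

variable (h : IsFourierTransform Φ)

include h

theorem counitFunctional_mul (x y : A) :
    counitFunctional Φ (Φ x * Φ y) = haar A (HopfAlgebra.antipode ℂ x * y) := by
  rw [← h.map_mul, counitFunctional_apply, counit_conv]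

/-- The antipode in x⋆ = S(x*) cancels the one in `counitFunctional_mul`, so Φ is isometric for ψ
and ω. -/
theorem counitFunctional_star_mul (x y : A) :
    counitFunctional Φ (star (Φ x) * Φ y) = haar A (star x * y) := by
  rw [h.map_star, h.counitFunctional_mul, convStar, antipode_antipode]

theorem map_star' (x : A) : Φ (star x) = convStar (Φ x) := by
  rw [convStar, h.map_star, h.map_antipode, convStar, antipode_antipode]

theorem map_integral : Φ (integral A) = 1 := by
  rw [← counitDagger_haar, h.map_one]

omit [StarRing A] [StarModule ℂ A] hA [StarRing B] [StarModule ℂ B] h in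
theorem finrank_eq (Φ : A ≃ₗ[ℂ] B) : Module.finrank ℂ B = Module.finrank ℂ A := Φ.finrank_eq.symm

theorem counitFunctional_one : counitFunctional Φ 1 = 1 := by
  rw [← h.map_integral, counitFunctional_apply, counit_integral]

/-- The slice of the comultiplication at Φ(x) is ∑ ω(Φ(bᵢ)) Φ(bᵢ* x) = Φ(Λ x), because ε(bᵢ) = ψ(Λ
bᵢ); then Λ x = ε(x) Λ and Φ(Λ) = 1. -/
theorem counitFunctional_leftInvariant (z : B) :
    sliceLeft (counitFunctional Φ) (comul (R := ℂ) z) = counitFunctional Φ z • 1 := by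
  obtain ⟨x, rfl⟩ := Φ.surjective z
  obtain ⟨b, hb⟩ := (isHaar_haar A).toIsFrobenius.exists_orthonormal
  rw [h.map_comul, mulDagger_apply (isHaar_haar A).toIsFrobenius hb]
  simp only [map_sum, TensorProduct.map_tmul, LinearEquiv.coe_coe, sliceLeft_tmul,
    counitFunctional_apply, ← haar_integral_mul (A := A)]
  simp only [← map_smul, ← map_sum, ← smul_mul_assoc, ← Finset.sum_mul]
  rw [hb.sum_apply_smul_star (isHaar_haar A).toIsFrobenius, integral_mul, map_smul,
    h.map_integral, map_smul, haar_integral, smul_eq_mul, mul_one]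

/-- The left invariant ω and the right invariant Haar functional are proportional; their values at 1
are 1 and n. -/
theorem haar_dual [FiniteQuantumGroup B] :
    haar B = (Module.finrank ℂ A : ℂ) • counitFunctional Φ := by
  ext z
  have := apply_mul_apply_one_of_invariant h.counitFunctional_leftInvariant
    (haar_rightInvariant (A := B)) z
  rw [h.counitFunctional_one, haar_one, finrank_eq Φ, mul_one] at this
  rw [← this, LinearMap.smul_apply, smul_eq_mul, mul_comm]

/-- The scalar c is kept free so that both normalizations of the dual functional are covered at
once. -/
theorem powForm_map (c : ℂ) (k : ℕ) (x y : ⨂[ℂ]^k A) :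
    powForm (c • counitFunctional Φ) k (powMap Φ k x) (powMap Φ k y) =
      c ^ k * powForm (haar A) k (powAntipode A k x) y := by
  induction x using tensorPower_induction with
  | add x x' hx hx' => simp only [map_add, LinearMap.add_apply, hx, hx', mul_add]
  | tprod r f =>
    induction y using tensorPower_induction with
    | add y y' hy hy' => simp only [map_add, hy, hy', mul_add]
    | tprod s g =>
      simp only [map_smul, LinearMap.smul_apply, powAntipode_tprod, powMap_tprod,
        powForm_tprod, h.counitFunctional_mul, smul_eq_mul,
        Finset.prod_mul_distrib, Finset.prod_const, Finset.card_univ, Fintype.card_fin]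
      ring

omit hA in
theorem powAntipode_powMap {k : ℕ} (x : ⨂[ℂ]^k A) :
    powAntipode B k (powMap Φ k x) = powMap Φ k (powAntipode A k x) := by
  induction x using tensorPower_induction with
  | add x y hx hy => simp only [map_add, hx, hy]
  | tprod c f => simp [h.map_antipode]

theorem powAntipode_powAntipode_dual {k : ℕ} (y : ⨂[ℂ]^k B) :
    powAntipode B k (powAntipode B k y) = y := by
  obtain ⟨x, rfl⟩ := powMap_surjective Φ k y
  rw [h.powAntipode_powMap, h.powAntipode_powMap, powAntipode_powAntipode]

omit hA in
theorem powStar_powMap {k : ℕ} (x : ⨂[ℂ]^k A) :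
    powStar k (powMap Φ k x) = powMap Φ k (powAntipode A k (powStar k x)) := by
  induction x using tensorPower_induction with
  | add x y hx hy => simp only [map_add, hx, hy]
  | tprod c f =>
    simp only [map_smul, powMap_tprod, powStar_smul, powStar_tprod, powAntipode_tprod]
    congr 2
    ext i
    exact h.map_star (f i)

theorem powInner_map (c : ℂ) (k : ℕ) (x y : ⨂[ℂ]^k A) :
    powInner (c • counitFunctional Φ) k (powMap Φ k x) (powMap Φ k y) =
      c ^ k * powInner (haar A) k x y := by
  rw [powInner_eq_powForm, h.powStar_powMap, h.powForm_map, powAntipode_powAntipode,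
    powInner_eq_powForm]

theorem powBilin_map (c : ℂ) (k : ℕ) (x y : ⨂[ℂ]^k A) :
    powBilin (c • counitFunctional Φ) k (powMap Φ k x) (powMap Φ k y) =
      c ^ k * powBilin (haar A) k x (powAntipode A k y) := by
  rw [powBilin_eq_powForm, powRev_powMap, h.powForm_map, powForm_powAntipode, powBilin_eq_powForm]

theorem innerTwo_map (c : ℂ) (X Y : A ⊗[ℂ] A) :
    innerTwo (c • counitFunctional Φ) (TensorProduct.map Φ.toLinearMap Φ.toLinearMap X)
      (TensorProduct.map Φ.toLinearMap Φ.toLinearMap Y) = c ^ 2 * innerTwo (haar A) X Y := by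
  simp only [innerTwo_eq]
  induction X with
  | zero => simp
  | add X X' hX hX' => simp only [map_add, star_add, add_mul, mul_add, hX, hX']
  | tmul p q =>
    induction Y with
    | zero => simp
    | add Y Y' hY hY' => simp only [map_add, mul_add, hY, hY']
    | tmul x y =>
      simp only [TensorProduct.map_tmul, LinearEquiv.coe_coe, TensorProduct.star_tmul,
        Algebra.TensorProduct.tmul_mul_tmul, tensorFunctional_tmul, LinearMap.smul_apply,
        smul_eq_mul, h.counitFunctional_star_mul]
      ring

variable {c : ℂ} (hc : c ≠ 0)

include hc

theorem powForm_dual_ext {k : ℕ} {w w' : ⨂[ℂ]^k B}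
    (hw : ∀ v, powForm (c • counitFunctional Φ) k v w =
      powForm (c • counitFunctional Φ) k v w') : w = w' := by
  obtain ⟨y, rfl⟩ := powMap_surjective Φ k w
  obtain ⟨y', rfl⟩ := powMap_surjective Φ k w'
  congr 1
  rw [← sub_eq_zero]
  refine (isHaar_haar A).toIsFrobenius.powForm_nondegenerate _ fun x => ?_
  have := hw (powMap Φ k (powAntipode A k x))
  rw [h.powForm_map, h.powForm_map, powAntipode_powAntipode] at this
  rw [map_sub, mul_left_cancel₀ (pow_ne_zero k hc) this, sub_self]

/-- The transform multiplies inner products by c ^ k on the source and c ^ l on the target, which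
rescales the adjoint by their quotient. -/
theorem dagger_hat {k l : ℕ} (T : (⨂[ℂ]^k A) →ₗ[ℂ] ⨂[ℂ]^l A) :
    dagger (c • counitFunctional Φ) (hat Φ T) =
      c ^ ((l : ℤ) - (k : ℤ)) • hat Φ (dagger (haar A) T) := by
  refine adjointMap_eq (fun w w' hw => h.powForm_dual_ext hc fun v => ?_) fun v w => ?_
  · simpa [powInner_eq_powForm] using hw (powStar k v)
  · obtain ⟨x, rfl⟩ := powMap_surjective Φ k v
    obtain ⟨y, rfl⟩ := powMap_surjective Φ l w
    rw [hat_powMap, h.powInner_map, LinearMap.smul_apply, hat_powMap, ← map_smul, h.powInner_map,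
      (isHaar_haar A).toIsFrobenius.powInner_dagger, powInner_eq_powForm, powInner_eq_powForm,
      map_smul, smul_eq_mul, ← mul_assoc, ← zpow_natCast c k, ← zpow_add₀ hc]
    simp

theorem hat_dagger {k l : ℕ} (T : (⨂[ℂ]^k A) →ₗ[ℂ] ⨂[ℂ]^l A) :
    hat Φ (dagger (haar A) T) =
      c ^ ((k : ℤ) - (l : ℤ)) • dagger (c • counitFunctional Φ) (hat Φ T) := by
  rw [h.dagger_hat hc, smul_smul, ← zpow_add₀ hc]
  simp

/-- The bilinear forms carry an antipode as well, whence the conjugation by tensor powers of S. The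
factor r lets the lemma apply directly to the rescaled adjoint from `dagger_hat`. -/
theorem transpose_hat {k l : ℕ} (r : ℂ) (T : (⨂[ℂ]^k A) →ₗ[ℂ] ⨂[ℂ]^l A) :
    transpose (c • counitFunctional Φ) (r • hat Φ T) =
      (r * c ^ ((l : ℤ) - (k : ℤ))) •
        (powAntipode B k ∘ₗ hat Φ (transpose (haar A) T) ∘ₗ powAntipode B l) := by
  refine adjointMap_eq (fun w w' hw => h.powForm_dual_ext hc fun v => ?_) fun v w => ?_
  · simpa [powBilin_eq_powForm, powRev_powRev] using hw (powRev B k v)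
  · obtain ⟨x, rfl⟩ := powMap_surjective Φ k v
    obtain ⟨y, rfl⟩ := powMap_surjective Φ l w
    simp only [LinearMap.smul_apply, LinearMap.comp_apply, h.powAntipode_powMap, hat_powMap,
      ← map_smul, h.powBilin_map, powAntipode_powAntipode]
    simp only [powBilin_eq_powForm, map_smul, LinearMap.smul_apply]
    have := (isHaar_haar A).toIsFrobenius.powBilin_transpose T x (powAntipode A l y)
    rw [powBilin_eq_powForm, powBilin_eq_powForm] at this
    have hcl : c ^ l = c ^ ((l : ℤ) - (k : ℤ)) * c ^ k := by
      rw [← zpow_natCast c k, ← zpow_add₀ hc]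
      simp
    rw [this, hcl]
    simp only [smul_eq_mul]
    ring

theorem hat_transpose {k l : ℕ} (T : (⨂[ℂ]^k A) →ₗ[ℂ] ⨂[ℂ]^l A) :
    hat Φ (transpose (haar A) T) =
      c ^ ((k : ℤ) - (l : ℤ)) • (powAntipode B k ∘ₗ
        transpose (c • counitFunctional Φ) (hat Φ T) ∘ₗ powAntipode B l) := by
  have := h.transpose_hat hc 1 T
  rw [one_smul, one_mul] at this
  refine LinearMap.ext fun y => ?_
  rw [this]
  simp only [LinearMap.smul_apply, LinearMap.comp_apply, map_smul, smul_smul,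
    h.powAntipode_powAntipode_dual, ← zpow_add₀ hc]
  simp

/-- The adjoint contributes c ^ (l - k) and the transpose, which acts on a map in the opposite
direction, c ^ (k - l); these cancel. -/
theorem hat_conjugate {k l : ℕ} (T : (⨂[ℂ]^k A) →ₗ[ℂ] ⨂[ℂ]^l A) :
    hat Φ (conjugate (haar A) T) =
      powAntipode B l ∘ₗ conjugate (c • counitFunctional Φ) (hat Φ T) ∘ₗ powAntipode B k := by
  refine LinearMap.ext fun y => ?_
  rw [conjugate, conjugate, h.dagger_hat hc, h.transpose_hat hc, ← zpow_add₀ hc]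
  simp [h.powAntipode_powAntipode_dual]

theorem conv_dual (x y : A) :
    conv (c • counitFunctional Φ) (Φ x) (Φ y) = c • Φ (x * y) := by
  -- The comultiplication of B is the transported m†, whose adjoint is m. The inner product scales
  -- by c ^ 2 on the tensor square and by c on B, leaving one factor c.
  have hT : comulDagger (c • counitFunctional Φ) =
      c • (Φ.toLinearMap ∘ₗ LinearMap.mul' ℂ A ∘ₗ
        TensorProduct.map Φ.symm.toLinearMap Φ.symm.toLinearMap) := by
    refine adjointMap_eq (fun w w' hw => ?_) fun v X => ?_
    · obtain ⟨y, rfl⟩ := Φ.surjective w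
      obtain ⟨y', rfl⟩ := Φ.surjective w'
      congr 1
      refine haar_ext fun z => ?_
      have := hw (Φ (star z))
      simp only [innerOne, LinearMap.smul_apply, h.counitFunctional_star_mul, star_star,
        smul_eq_mul] at this
      exact mul_left_cancel₀ hc this
    · obtain ⟨z, rfl⟩ := Φ.surjective v
      obtain ⟨Y, rfl⟩ : ∃ Y, TensorProduct.map Φ.toLinearMap Φ.toLinearMap Y = X :=
        (TensorProduct.congr Φ Φ).surjective X
      have hY : TensorProduct.map Φ.symm.toLinearMap Φ.symm.toLinearMap
          (TensorProduct.map Φ.toLinearMap Φ.toLinearMap Y) = Y :=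
        (TensorProduct.congr Φ Φ).symm_apply_apply Y
      rw [h.map_comul, h.innerTwo_map, innerTwo_mulDagger, LinearMap.smul_apply,
        LinearMap.comp_apply, LinearMap.comp_apply, hY, innerOne, innerOne, mul_smul_comm,
        map_smul, LinearMap.smul_apply, LinearEquiv.coe_coe, h.counitFunctional_star_mul]
      simp only [smul_eq_mul]
      ring
  rw [conv, hT]
  simp

end IsFourierTransform

end Fourier

end FinQG

/-! ### The main theorem -/

theorem mainTheorem5 (A : Type u) [Ring A] [HopfAlgebra ℂ A] [StarRing A] [StarModule ℂ A]
    [FinQG.FiniteQuantumGroup A] :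
    -- the normalized Haar functional exists and is unique, and `n = η†η = dim C(Γ)`
    (∀ ψ : A →ₗ[ℂ] ℂ, FinQG.IsHaar ψ ↔ ψ = FinQG.haar A) ∧
    FinQG.haar A 1 = (Module.finrank ℂ A : ℂ) ∧
    -- the dual finite quantum group and the Fourier transform exist
    (∃ (B : Type u) (_ : Ring B) (_ : HopfAlgebra ℂ B) (_ : StarRing B) (_ : StarModule ℂ B)
      (_ : FinQG.FiniteQuantumGroup B) (Φ : A ≃ₗ[ℂ] B), FinQG.IsFourierTransform Φ) ∧
    -- for every realization of the dual, with `n = dim C(Γ)` and `ω = ε ∘ Φ⁻¹`: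
    ∀ (B : Type v) [Ring B] [HopfAlgebra ℂ B] [StarRing B] [StarModule ℂ B]
      [FinQG.FiniteQuantumGroup B] (Φ : A ≃ₗ[ℂ] B), FinQG.IsFourierTransform Φ →
      ∀ (n : ℂ) (ω : B →ₗ[ℂ] ℂ), n = (Module.finrank ℂ A : ℂ) →
        ω = Coalgebra.counit (R := ℂ) (A := A) ∘ₗ Φ.symm.toLinearMap →
        FinQG.haar B = n • ω ∧
        -- adjoint, transpose and conjugate, for the normalized Haar functionals
        (∀ (k l : ℕ) (T : (⨂[ℂ]^k A) →ₗ[ℂ] ⨂[ℂ]^l A),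
          FinQG.hat Φ (FinQG.dagger (FinQG.haar A) T) =
            n ^ ((k : ℤ) - (l : ℤ)) • FinQG.dagger (FinQG.haar B) (FinQG.hat Φ T) ∧
          FinQG.hat Φ (FinQG.transpose (FinQG.haar A) T) =
            n ^ ((k : ℤ) - (l : ℤ)) • (FinQG.powAntipode B k ∘ₗ
              FinQG.transpose (FinQG.haar B) (FinQG.hat Φ T) ∘ₗ FinQG.powAntipode B l) ∧
          FinQG.hat Φ (FinQG.conjugate (FinQG.haar A) T) =
            FinQG.powAntipode B l ∘ₗ
              FinQG.conjugate (FinQG.haar B) (FinQG.hat Φ T) ∘ₗ FinQG.powAntipode B k) ∧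
        -- products and involutions, for the normalized Haar functionals
        (∀ x y : A,
          Φ (FinQG.conv (FinQG.haar A) x y) = Φ x * Φ y ∧
          Φ (x * y) = n⁻¹ • FinQG.conv (FinQG.haar B) (Φ x) (Φ y) ∧
          Φ (FinQG.convStar x) = star (Φ x) ∧
          Φ (star x) = FinQG.convStar (Φ x)) ∧
        -- the formulas that involve the Haar functional of the dual, when the latter is scaled
        -- to `n⁻¹ ω` instead
        (∀ (k l : ℕ) (T : (⨂[ℂ]^k A) →ₗ[ℂ] ⨂[ℂ]^l A),
          FinQG.hat Φ (FinQG.dagger (FinQG.haar A) T) =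
            n ^ ((l : ℤ) - (k : ℤ)) • FinQG.dagger (n⁻¹ • ω) (FinQG.hat Φ T) ∧
          FinQG.hat Φ (FinQG.transpose (FinQG.haar A) T) =
            n ^ ((l : ℤ) - (k : ℤ)) • (FinQG.powAntipode B k ∘ₗ
              FinQG.transpose (n⁻¹ • ω) (FinQG.hat Φ T) ∘ₗ FinQG.powAntipode B l) ∧
          FinQG.hat Φ (FinQG.conjugate (FinQG.haar A) T) =
            FinQG.powAntipode B l ∘ₗ
              FinQG.conjugate (n⁻¹ • ω) (FinQG.hat Φ T) ∘ₗ FinQG.powAntipode B k) ∧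
        (∀ x y : A, Φ (x * y) = n • FinQG.conv (n⁻¹ • ω) (Φ x) (Φ y)) := by
  refine ⟨fun ψ => FinQG.isHaar_iff, FinQG.haar_one A,
    ⟨FinQG.DualAlgebra A, inferInstance, inferInstance, inferInstance, inferInstance,
      inferInstance, FinQG.DualAlgebra.fourier A, FinQG.DualAlgebra.isFourierTransform_fourier⟩, ?_⟩
  intro B _ _ _ _ _ Φ h n ω hn hω
  have hn0 : n ≠ 0 := hn ▸ FinQG.finrank_ne_zero
  have hω' : ω = FinQG.counitFunctional Φ := hω
  have hhaar : FinQG.haar B = n • ω := by rw [h.haar_dual, hn, hω']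
  -- The last set of formulas is the case c = n⁻¹, where inverting the base exchanges k and l in the
  -- exponent.
  have hinv : ∀ k l : ℕ, n⁻¹ ^ ((k : ℤ) - (l : ℤ)) = n ^ ((l : ℤ) - (k : ℤ)) := fun k l => by
    rw [inv_zpow', neg_sub]
  refine ⟨hhaar, fun k l T => ?_, fun x y => ⟨h.map_mul x y, ?_, (h.map_star x).symm,
    h.map_star' x⟩, fun k l T => ?_, fun x y => ?_⟩
  · rw [hhaar, hω']
    exact ⟨h.hat_dagger hn0 T, h.hat_transpose hn0 T, h.hat_conjugate hn0 T⟩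
  · rw [hhaar, hω', h.conv_dual hn0, smul_smul, inv_mul_cancel₀ hn0, one_smul]
  · rw [hω', ← hinv]
    exact ⟨h.hat_dagger (inv_ne_zero hn0) T, h.hat_transpose (inv_ne_zero hn0) T,
      h.hat_conjugate (inv_ne_zero hn0) T⟩
  · rw [hω', h.conv_dual (inv_ne_zero hn0), smul_smul, mul_inv_cancel₀ hn0, one_smul]
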